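/- Let $\mathcal L_{\mathrm{field}}=\{+,\cdot,-,{}^{-1},0,1\}$ be the language of fields (with $0^{-1}=0$), let $\mathcal L_0$ be an expansion of $\mathcal L_{\mathrm{field}}$, and let $T_0$ be a complete and model complete $\mathcal L_0$-theory of fields of characteristic zero. Let $\mathcal U_0$ be a monster model of $T_0$, and write $A\leq_{\mathcal L} B$ for "$A$ is an $\mathcal L$-substructure of $B$" and $\operatorname{acl}_0$ for model-theoretic algebraic closure in $\mathcal U_0$. All substructures of $\mathcal U_0$ called $K,L,E,A,B,C$ below are small. Let $\perp^0$ be an automorphism invariant ternary relation on small subsets of $\mathcal U_0$; write $A\perp^0_C B$. Assume: 1. $\perp^0$ implies algebraic disjointness: if $K,L\leq_{\mathcal L_0}\mathcal U_0$ have a common $\mathcal L_0$-substructure $E$ and $K\perp^0_E L$, then $K$ and $L$ are algebraically disjoint over $E$ (subsets of $K$ that are algebraically independent over $E$ remain so over $L$). 2. $\perp^0$ implies $\mathcal L_0$-compositums: if $K,L\leq_{\mathcal L_0}\mathcal U_0$ and $K\perp^0_E L$ for some $E=\operatorname{acl}_0(E)\cap K=\operatorname{acl}_0(E)\cap L$,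 then the compositum $K\cdot L$ is an $\mathcal L_0$-substructure of $\mathcal U_0$. 3. $T_0$ is very $\mathcal L_0$-slim: for every $F\leq_{\mathcal L_0}\mathcal U_0$ we have $\operatorname{acl}_0(F)=F^{\mathrm{alg}}\cap\mathcal U_0$. Let $k$ be a field of characteristic zero, and let $\mathcal D$ be a finite-dimensional commutative $k$-algebra that is a local ring with residue field $k$, equipped with a $k$-basis $\epsilon_0=1,\epsilon_1,\dots,\epsilon_d$ such that $\epsilon_1,\dots,\epsilon_d$ lie in the maximal ideal. A $\mathcal D$-field is a field $K$ that is also a $k$-algebra, equipped with maps $\partial_1,\dots,\partial_d\colon K\to K$ such that $$K\to K\otimes_k\mathcal D,\qquad a\mapsto a\otimes\epsilon_0+\partial_1(a)\otimes\epsilon_1+\dots+\partial_d(a)\otimes\epsilon_d$$ is a homomorphism of $k$-algebras. Let $\mathcal L_{\mathcal D}$ be $\mathcal L_0$ expanded by unary function symbols for multiplication by the elements of $k$ and for $\partial_1,\dots,\partial_d$. Let $T_{\mathcal D}$ be the $\mathcal L_{\mathcal D}$-theory consisting of $T_0$ and the theory of $\mathcal D$-fields, and let $T_{\mathcal D^*}$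 be $T_{\mathcal D}$ together with the sentences saying that the $\partial_i$ commute pairwise. Then both $T=T_{\mathcal D}$ and $T=T_{\mathcal D^*}$ are derivation-like with respect to $(T_0,\perp^0)$. That is, $T$ contains the universal part of $T_0$ (up to deduction) and, with $\mathcal L=\mathcal L_{\mathcal D}$ and $T^\forall$ the set of universal consequences of $T$: whenever $A,B,C\models T^\forall$, with $C$ a common $\mathcal L$-substructure of $A$ and $B$, are such that $A,B\leq_{\mathcal L_0}\mathcal U_0$, $\operatorname{acl}_0(C)\cap A=\operatorname{acl}_0(C)\cap B=C$ and $A\perp^0_C B$, then (i) there exists $M\models T$ such that $M\leq_{\mathcal L_0}\mathcal U_0$ and $A,B\leq_{\mathcal L}M$; and (ii) for any $M$ as in (i) and any $\mathcal L_0$-structure $D$ with $\langle A,B\rangle_{\mathcal L_0}\leq_{\mathcal L_0}D\leq_{\mathcal L_0}\operatorname{acl}_0(A,B)\cap M$, we have $D\leq_{\mathcal L}M$, and this $\mathcal L$-structure on $D$ is the unique one that expands its $\mathcal L_0$-structure, makes it a model of $T^\forall$, and extends the $\mathcal L$-structures of $A$ and $B$. -/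

import Mathlib

universe u v w u₁ v₁ u₂ v₂

open FirstOrder FirstOrder.Language Cardinal TensorProduct

namespace DerivLike

section Monster

variable {L₀ : FirstOrder.Language.{u, v}} {U : Type w} [L₀.Structure U]

/-- A theory is model complete if every embedding between models of it is elementary. -/
def IsModelComplete (T₀ : L₀.Theory) : Prop :=
  ∀ (M N : Theory.ModelType.{u, v, max u v} T₀) (f : M ↪[L₀] N) (n : ℕ)
    (ψ : L₀.Formula (Fin n)) (x : Fin n → M), ψ.Realize (f ∘ x) ↔ ψ.Realize x

/-- A subset of `U` is small if it has fewer than `κ` elements. -/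
def IsSmall (κ : Cardinal.{w}) (A : Set U) : Prop := #A < κ

variable (L₀) in
/-- `κ`-saturation: a set of formulas in one variable over a small set of parameters that is
finitely satisfiable in `U` is realized in `U`. -/
def IsSaturated (U : Type w) [L₀.Structure U] (κ : Cardinal.{w}) : Prop :=
  ∀ A : Set U, IsSmall κ A → ∀ p : Set (L₀[[A]].Formula Unit),
    (∀ q : Finset (L₀[[A]].Formula Unit), (q : Set _) ⊆ p →
      ∃ a : U, ∀ ψ ∈ q, ψ.Realize (fun _ => a)) →
    ∃ a : U, ∀ ψ ∈ p, ψ.Realize (fun _ => a)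

variable (L₀) in
/-- Strong `κ`-homogeneity: a partial elementary map defined on a small set extends to an
automorphism of `U`. -/
def IsStronglyHomogeneous (U : Type w) [L₀.Structure U] (κ : Cardinal.{w}) : Prop :=
  ∀ A : Set U, IsSmall κ A → ∀ f : A → U,
    (∀ ψ : L₀.Formula A, ψ.Realize (fun a : A => (a : U)) ↔ ψ.Realize f) →
    ∃ σ : U ≃[L₀] U, ∀ a : A, σ a = f a

/-- `U` is a monster model of `T₀`, where "small" means "of cardinality less than `κ`". -/
structure IsMonster (T₀ : L₀.Theory) (U : Type w) [L₀.Structure U] (κ : Cardinal.{w}) :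
    Prop where
  model : U ⊨ T₀
  aleph0_lt : ℵ₀ < κ
  card_lt : Cardinal.lift.{w} L₀.card < Cardinal.lift.{max u v} κ
  saturated : IsSaturated L₀ U κ
  homogeneous : IsStronglyHomogeneous L₀ U κ

variable (L₀) in
/-- Model-theoretic algebraic closure: the union of all finite `A`-definable subsets of `U`. -/
def acl (A : Set U) : Set U :=
  {a | ∃ s : Set U, A.Definable₁ L₀ s ∧ s.Finite ∧ a ∈ s}

variable (L₀) in
/-- Automorphism invariance of a ternary relation on small subsets of `U`. Here and below
`ind A C B` stands for "`A` is independent from `B` over `C`"; only its values at small sets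
matter. -/
def IsInvariant (κ : Cardinal.{w}) (ind : Set U → Set U → Set U → Prop) : Prop :=
  ∀ (σ : U ≃[L₀] U) (A C B : Set U), IsSmall κ A → IsSmall κ C → IsSmall κ B →
    ind A C B → ind (σ '' A) (σ '' C) (σ '' B)

end Monster

section DerivationLike

variable {L₀ : FirstOrder.Language.{u, v}} {L : FirstOrder.Language.{u₁, v₁}} (φ : L₀ →ᴸ L)

/-- The set of universal consequences of a theory. -/
def univPart (T : L.Theory) : L.Theory :=
  {σ | σ.IsUniversal ∧ T ⊨ᵇ σ}

/-- An `L`-structure whose `L₀`-reduct is a substructure of the `L₀`-structure `U`. -/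
structure ExpSub (U : Type w) [L₀.Structure U] where
  carrier : L₀.Substructure U
  str : L.Structure carrier
  isExpansion : φ.IsExpansionOn carrier

attribute [instance] ExpSub.str

variable {φ} {U : Type w} [L₀.Structure U]

/-- `X ⊨ T`. -/
def ExpSub.Models (X : ExpSub φ U) (T : L.Theory) : Prop := X.carrier ⊨ T

/-- `X` is an `L`-substructure of `Y`: it is a subset of `Y`, and the inclusion is an embedding
of `L`-structures. -/
def ExpSub.IsSub (X Y : ExpSub φ U) : Prop :=
  ∃ f : X.carrier ↪[L] Y.carrier, ∀ x, (f x : U) = x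

/-- `T` is derivation-like with respect to `(T₀, ind)`, where `ind` is a ternary relation on the
small subsets of the monster model `U` of `T₀`. -/
structure IsDerivationLike (φ : L₀ →ᴸ L) (T₀ : L₀.Theory) (T : L.Theory)
    (U : Type w) [L₀.Structure U] (κ : Cardinal.{w})
    (ind : Set U → Set U → Set U → Prop) : Prop where
  /-- the universal part of `T₀` is contained in (the deductive closure of) `T` -/
  univPart_le : ∀ σ ∈ univPart T₀, T ⊨ᵇ φ.onSentence σ
  /-- condition (i) -/
  amalgamation : ∀ A B C : ExpSub φ U,
    A.Models (univPart T) → B.Models (univPart T) → C.Models (univPart T) →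
    IsSmall κ (A.carrier : Set U) → IsSmall κ (B.carrier : Set U) →
    C.IsSub A → C.IsSub B →
    acl L₀ (C.carrier : Set U) ∩ A.carrier = C.carrier →
    acl L₀ (C.carrier : Set U) ∩ B.carrier = C.carrier →
    ind A.carrier C.carrier B.carrier →
    ∃ M : ExpSub φ U, M.Models T ∧ A.IsSub M ∧ B.IsSub M
  /-- condition (ii): every `L₀`-structure `D` between the structure generated by `A ∪ B` and
  `acl (A ∪ B) ∩ M` is an `L`-substructure `X` of `M`, and the `L`-structure of `X` is the only
  one on `D` that expands the `L₀`-structure of `D`, is a model of the universal part of `T` and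
  extends the `L`-structures of `A` and `B`. -/
  closure : ∀ A B C : ExpSub φ U,
    A.Models (univPart T) → B.Models (univPart T) → C.Models (univPart T) →
    IsSmall κ (A.carrier : Set U) → IsSmall κ (B.carrier : Set U) →
    C.IsSub A → C.IsSub B →
    acl L₀ (C.carrier : Set U) ∩ A.carrier = C.carrier →
    acl L₀ (C.carrier : Set U) ∩ B.carrier = C.carrier →
    ind A.carrier C.carrier B.carrier →
    ∀ M : ExpSub φ U, M.Models T → A.IsSub M → B.IsSub M →
    ∀ D : L₀.Substructure U,
      Substructure.closure L₀ ((A.carrier : Set U) ∪ B.carrier) ≤ D →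
      (D : Set U) ⊆ acl L₀ ((A.carrier : Set U) ∪ B.carrier) ∩ M.carrier →
    ∃ X : ExpSub φ U, X.carrier = D ∧ X.IsSub M ∧
      ∀ Y : ExpSub φ U,
        (Y.carrier = D ∧ Y.Models (univPart T) ∧ A.IsSub Y ∧ B.IsSub Y) ↔ Y = X

end DerivationLike

section Fields

/-- The function symbols of the language of fields. -/
inductive FieldFunc : ℕ → Type
  | add : FieldFunc 2
  | mul : FieldFunc 2
  | neg : FieldFunc 1
  | inv : FieldFunc 1
  | zero : FieldFunc 0
  | one : FieldFunc 0

/-- The language of fields `{+, *, -, ⁻¹, 0, 1}`. -/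
def fieldLang : FirstOrder.Language.{0, 0} := ⟨FieldFunc, fun _ => Empty⟩

/-- A field as a structure in the language of fields (with `0⁻¹ = 0`). -/
instance fieldStructure (K : Type w) [Field K] : fieldLang.Structure K where
  funMap := fun f => match f with
    | .add => fun x => x 0 + x 1
    | .mul => fun x => x 0 * x 1
    | .neg => fun x => - x 0
    | .inv => fun x => (x 0)⁻¹
    | .zero => fun _ => 0
    | .one => fun _ => 1
  RelMap := fun r => r.elim

variable {L₀ : FirstOrder.Language.{u, v}} {U : Type w} [L₀.Structure U] [Field U]

/-- Algebraic disjointness (algebraic independence) of fields `K` and `L` over a common subfield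
`E`: every subset of `K` that is algebraically independent over `E` is algebraically independent
over `L`. For a set `A` that is a subfield, `Subfield.closure A` is `A`. -/
def AlgDisjoint (K E L : Set U) : Prop :=
  ∀ s : Set U, s ⊆ K →
    AlgebraicIndependent (Subfield.closure E) ((↑) : s → U) →
    AlgebraicIndependent (Subfield.closure L) ((↑) : s → U)

variable (L₀) in
/-- `ind` implies algebraic disjointness. -/
def ImpliesAlgDisjoint (κ : Cardinal.{w}) (ind : Set U → Set U → Set U → Prop) : Prop :=
  ∀ K E L : L₀.Substructure U, E ≤ K → E ≤ L →
    IsSmall κ (K : Set U) → IsSmall κ (L : Set U) →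
    ind K E L → AlgDisjoint (K : Set U) E L

variable (L₀) in
/-- `ind` implies `L₀`-compositums: the compositum of `K` and `L` is an `L₀`-substructure. -/
def ImpliesCompositums (κ : Cardinal.{w}) (ind : Set U → Set U → Set U → Prop) : Prop :=
  ∀ K E L : L₀.Substructure U,
    IsSmall κ (K : Set U) → IsSmall κ (L : Set U) →
    acl L₀ (E : Set U) ∩ K = E → acl L₀ (E : Set U) ∩ L = E →
    ind K E L →
    ∃ S : L₀.Substructure U, (S : Set U) = Subfield.closure ((K : Set U) ∪ L)

variable (L₀ U) in
/-- Very `L₀`-slim: on `L₀`-substructures, model-theoretic algebraic closure is relative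
field-theoretic algebraic closure. -/
def IsVerySlim : Prop :=
  ∀ F : L₀.Substructure U,
    acl L₀ (F : Set U) = {a : U | IsAlgebraic (Subfield.closure (F : Set U)) a}

end Fields

section DFields

/-- The new function symbols: scalar multiplication by the elements of `k`, and the operators
`∂ᵢ`, here indexed by `Fin d`. -/
inductive OpFunc (k : Type u₁) (d : ℕ) : ℕ → Type u₁
  | smul (c : k) : OpFunc k d 1
  | der (i : Fin d) : OpFunc k d 1

/-- The language of the new symbols. -/
def opLang (k : Type u₁) (d : ℕ) : FirstOrder.Language.{u₁, 0} := ⟨OpFunc k d, fun _ => Empty⟩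

/-- `L₀` expanded by scalar multiplication by elements of `k` and by `∂₁, …, ∂_d`. -/
abbrev dLang (L₀ : FirstOrder.Language.{u, v}) (k : Type u₁) (d : ℕ) : FirstOrder.Language.{max u u₁, v} :=
  L₀.sum (opLang k d)

variable {L₀ : FirstOrder.Language.{u, v}} (φ : fieldLang →ᴸ L₀) {k : Type u₁} {d : ℕ} {α : Type u₂}

/-- The symbols of the language of fields as symbols of `dLang`. -/
def fieldSym {n : ℕ} (f : FieldFunc n) : (dLang L₀ k d).Functions n :=
  Sum.inl (φ.onFunction (f : fieldLang.Functions n))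

/-- The symbol for scalar multiplication by `c`. -/
def smulSym (c : k) : (dLang L₀ k d).Functions 1 := Sum.inr (OpFunc.smul c)

/-- The symbol `∂ᵢ`. -/
def derSym (i : Fin d) : (dLang L₀ k d).Functions 1 := Sum.inr (OpFunc.der i)

/-- The term `s + t`. -/
def addT (s t : (dLang L₀ k d).Term α) : (dLang L₀ k d).Term α :=
  Functions.apply₂ (fieldSym φ FieldFunc.add) s t

/-- The term `s * t`. -/
def mulT (s t : (dLang L₀ k d).Term α) : (dLang L₀ k d).Term α :=
  Functions.apply₂ (fieldSym φ FieldFunc.mul) s t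

variable (k d α) in
/-- The term `0`. -/
def zeroT : (dLang L₀ k d).Term α :=
  Constants.term (fieldSym φ FieldFunc.zero)

variable (k d α) in
/-- The term `1`. -/
def oneT : (dLang L₀ k d).Term α :=
  Constants.term (fieldSym φ FieldFunc.one)

/-- The term `c • t`. -/
def smulT (c : k) (t : (dLang L₀ k d).Term α) : (dLang L₀ k d).Term α :=
  Functions.apply₁ (smulSym c) t

/-- The term `∂ᵢ t`. -/
def derT (i : Fin d) (t : (dLang L₀ k d).Term α) : (dLang L₀ k d).Term α :=
  Functions.apply₁ (derSym i) t

/-- The term `∂ᵢ t` for `0 ≤ i ≤ d`, where `∂₀` is the identity. -/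
def derT' (i : Fin (d + 1)) (t : (dLang L₀ k d).Term α) : (dLang L₀ k d).Term α :=
  Fin.cases t (fun j => derT j t) i

/-- The sum of a list of terms. -/
def sumT (l : List ((dLang L₀ k d).Term α)) : (dLang L₀ k d).Term α :=
  l.foldr (addT φ) (zeroT φ k d α)

/-- The variable `x`. -/
def vx {n : ℕ} : (dLang L₀ k d).Term (Empty ⊕ Fin (n + 1)) := Term.var (Sum.inr 0)

/-- The variable `y`. -/
def vy : (dLang L₀ k d).Term (Empty ⊕ Fin 2) := Term.var (Sum.inr 1)

/-- The sentence `∀ x, s = t`. -/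
def allEq₁ (s t : (dLang L₀ k d).Term (Empty ⊕ Fin 1)) : (dLang L₀ k d).Sentence :=
  (Term.bdEqual s t).all

/-- The sentence `∀ x y, s = t`. -/
def allEq₂ (s t : (dLang L₀ k d).Term (Empty ⊕ Fin 2)) : (dLang L₀ k d).Sentence :=
  (Term.bdEqual s t).all.all

variable [Field k] {D : Type v₂} [CommRing D] [Algebra k D]

variable (d) in
/-- Axioms of `k`-algebras, for rings. -/
def kAlgAxioms : (dLang L₀ k d).Theory :=
  Set.range (fun c : k =>
    allEq₂ (smulT c (addT φ vx vy)) (addT φ (smulT c vx) (smulT c vy))) ∪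
  Set.range (fun c : k × k =>
    allEq₁ (smulT (c.1 + c.2) vx) (addT φ (smulT c.1 vx) (smulT c.2 vx))) ∪
  Set.range (fun c : k × k => allEq₁ (smulT (c.1 * c.2) vx) (smulT c.1 (smulT c.2 vx))) ∪
  {allEq₁ (smulT 1 vx) vx} ∪
  Set.range (fun c : k => allEq₂ (smulT c (mulT φ vx vy)) (mulT φ (smulT c vx) vy))

/-- Axioms saying that `a ↦ a ⊗ ε₀ + ∂₁ a ⊗ ε₁ + ⋯ + ∂_d a ⊗ ε_d` is a homomorphism of
`k`-algebras: it is additive, `k`-linear, unital, and multiplicative. Multiplicativity is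
`∂ᵢ (x y) = ∑ⱼₗ cⱼₗⁱ ∂ⱼ x ∂ₗ y` for `0 ≤ i ≤ d`, where `cⱼₗⁱ` is the coefficient of `εᵢ` in
`εⱼ εₗ`; `realize_dAxioms_iff` below relates the axioms to the homomorphism. -/
def homAxioms (ε : Module.Basis (Fin (d + 1)) k D) : (dLang L₀ k d).Theory :=
  Set.range (fun i : Fin d =>
    allEq₂ (derT i (addT φ vx vy)) (addT φ (derT i vx) (derT i vy))) ∪
  Set.range (fun p : Fin d × k => allEq₁ (derT p.1 (smulT p.2 vx)) (smulT p.2 (derT p.1 vx))) ∪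
  Set.range (fun i : Fin d => allEq₁ (derT i (oneT φ k d _)) (zeroT φ k d _)) ∪
  Set.range (fun i : Fin (d + 1) =>
    allEq₂ (derT' i (mulT φ vx vy))
      (sumT φ ((List.finRange (d + 1)).map fun j => sumT φ ((List.finRange (d + 1)).map fun l =>
        smulT (ε.repr (ε j * ε l) i) (mulT φ (derT' j vx) (derT' l vy))))))

/-- The axioms of `𝒟`-fields, for fields. -/
def dAxioms (ε : Module.Basis (Fin (d + 1)) k D) : (dLang L₀ k d).Theory :=
  kAlgAxioms φ d ∪ homAxioms φ ε

variable (L₀ k d) in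
/-- Axioms saying that the operators `∂ᵢ` commute pairwise. -/
def commAxioms : (dLang L₀ k d).Theory :=
  Set.range (fun p : Fin d × Fin d =>
    allEq₁ (derT p.1 (derT p.2 vx)) (derT p.2 (derT p.1 vx)))

/-- `T_𝒟`: the theory `T₀` together with the theory of `𝒟`-fields. -/
def theoryD (T₀ : L₀.Theory) (ε : Module.Basis (Fin (d + 1)) k D) : (dLang L₀ k d).Theory :=
  LHom.sumInl.onTheory T₀ ∪ dAxioms φ ε

/-- `T_𝒟*`: the theory `T_𝒟` together with the commutation of the operators. -/
def theoryDStar (T₀ : L₀.Theory) (ε : Module.Basis (Fin (d + 1)) k D) :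
    (dLang L₀ k d).Theory :=
  theoryD φ T₀ ε ∪ commAxioms L₀ k d

end DFields

section Semantics

variable {L₀ : FirstOrder.Language.{u, v}} {φ : fieldLang →ᴸ L₀} {k : Type u₁} {d : ℕ}
  {M : Type w} [(dLang L₀ k d).Structure M]

variable (L₀ d) in
/-- The interpretation of scalar multiplication by `c`. -/
def smulM (c : k) (x : M) : M :=
  Structure.funMap (smulSym c : (dLang L₀ k d).Functions 1) ![x]

variable (L₀ k) in
/-- The interpretation of `∂ᵢ`. -/
def derM (i : Fin d) (x : M) : M :=
  Structure.funMap (derSym i : (dLang L₀ k d).Functions 1) ![x]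

variable (L₀ k) in
/-- The interpretation of `∂ᵢ` for `0 ≤ i ≤ d`, where `∂₀` is the identity. -/
def derM' (i : Fin (d + 1)) (x : M) : M := Fin.cases x (fun j => derM L₀ k j x) i

section

variable {α : Type u₂}

theorem realize_smulT (c : k) (t : (dLang L₀ k d).Term α) (x : α → M) :
    (smulT c t).realize x = smulM L₀ d c (t.realize x) :=
  Term.realize_functions_apply₁

theorem realize_derT (i : Fin d) (t : (dLang L₀ k d).Term α) (x : α → M) :
    (derT i t).realize x = derM L₀ k i (t.realize x) :=
  Term.realize_functions_apply₁

theorem realize_derT' (i : Fin (d + 1)) (t : (dLang L₀ k d).Term α) (x : α → M) :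
    (derT' i t).realize x = derM' L₀ k i (t.realize x) := by
  refine Fin.cases ?_ (fun j => ?_) i
  · rfl
  · exact realize_derT j t x

theorem realize_allEq₁ (s t : (dLang L₀ k d).Term (Empty ⊕ Fin 1)) :
    M ⊨ allEq₁ s t ↔ ∀ a : M, s.realize (Sum.elim default (fun _ => a))
      = t.realize (Sum.elim default (fun _ => a)) := by
  have h (a : M) : (Fin.snoc default a : Fin 1 → M) = fun _ => a := by
    funext i; fin_cases i; rfl
  simp only [allEq₁, Sentence.Realize, Formula.Realize, BoundedFormula.realize_all,
    BoundedFormula.realize_bdEqual, h]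

theorem realize_allEq₂ (s t : (dLang L₀ k d).Term (Empty ⊕ Fin 2)) :
    M ⊨ allEq₂ s t ↔ ∀ a b : M, s.realize (Sum.elim default ![a, b])
      = t.realize (Sum.elim default ![a, b]) := by
  have h (a b : M) : (Fin.snoc (Fin.snoc default a : Fin 1 → M) b : Fin 2 → M) = ![a, b] := by
    funext i; fin_cases i <;> rfl
  simp only [allEq₂, Sentence.Realize, Formula.Realize, BoundedFormula.realize_all,
    BoundedFormula.realize_bdEqual, h]

variable [Field M] [((LHom.sumInl : L₀ →ᴸ dLang L₀ k d).comp φ).IsExpansionOn M]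

theorem realize_addT (s t : (dLang L₀ k d).Term α) (x : α → M) :
    (addT φ s t).realize x = s.realize x + t.realize x := by
  refine Term.realize_functions_apply₂.trans ?_
  exact ((LHom.sumInl : L₀ →ᴸ dLang L₀ k d).comp φ).map_onFunction
    (FieldFunc.add : fieldLang.Functions 2) _

theorem realize_mulT (s t : (dLang L₀ k d).Term α) (x : α → M) :
    (mulT φ s t).realize x = s.realize x * t.realize x := by
  refine Term.realize_functions_apply₂.trans ?_
  exact ((LHom.sumInl : L₀ →ᴸ dLang L₀ k d).comp φ).map_onFunction
    (FieldFunc.mul : fieldLang.Functions 2) _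

theorem realize_zeroT (x : α → M) : (zeroT φ k d α).realize x = 0 := by
  refine Term.realize_constants.trans ?_
  exact ((LHom.sumInl : L₀ →ᴸ dLang L₀ k d).comp φ).map_onFunction
    (FieldFunc.zero : fieldLang.Functions 0) _

theorem realize_oneT (x : α → M) : (oneT φ k d α).realize x = 1 := by
  refine Term.realize_constants.trans ?_
  exact ((LHom.sumInl : L₀ →ᴸ dLang L₀ k d).comp φ).map_onFunction
    (FieldFunc.one : fieldLang.Functions 0) _

theorem realize_sumT {n : ℕ} (f : Fin n → (dLang L₀ k d).Term α) (x : α → M) :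
    (sumT φ ((List.finRange n).map f)).realize x = ∑ i, (f i).realize x := by
  have h : ∀ l : List ((dLang L₀ k d).Term α),
      (sumT φ l).realize x = (l.map fun t => t.realize x).sum := by
    intro l
    induction l with
    | nil => exact realize_zeroT x
    | cons t l ih => simpa [sumT, realize_addT] using ih
  rw [h, List.map_map, ← List.ofFn_eq_map, List.sum_ofFn]
  rfl

end

variable [Field k] {D : Type v₂} [CommRing D] [Algebra k D]
  [Field M] [((LHom.sumInl : L₀ →ᴸ dLang L₀ k d).comp φ).IsExpansionOn M]

theorem realize_kAlgAxioms :
    M ⊨ kAlgAxioms φ (k := k) d ↔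
      (∀ (c : k) (x y : M), smulM L₀ d c (x + y) = smulM L₀ d c x + smulM L₀ d c y) ∧
      (∀ (c c' : k) (x : M), smulM L₀ d (c + c') x = smulM L₀ d c x + smulM L₀ d c' x) ∧
      (∀ (c c' : k) (x : M), smulM L₀ d (c * c') x = smulM L₀ d c (smulM L₀ d c' x)) ∧
      (∀ x : M, smulM L₀ d (1 : k) x = x) ∧
      (∀ (c : k) (x y : M), smulM L₀ d c (x * y) = smulM L₀ d c x * y) := by
  simp only [kAlgAxioms, Theory.model_iff, Set.mem_union, or_imp, forall_and, Set.forall_mem_range,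
    Set.mem_singleton_iff, forall_eq, realize_allEq₁, realize_allEq₂, realize_smulT,
    realize_addT, realize_mulT, Prod.forall, and_assoc]
  rfl

theorem realize_homAxioms (ε : Module.Basis (Fin (d + 1)) k D) :
    M ⊨ homAxioms φ ε ↔
      (∀ (i : Fin d) (x y : M), derM L₀ k i (x + y) = derM L₀ k i x + derM L₀ k i y) ∧
      (∀ (i : Fin d) (c : k) (x : M),
        derM L₀ k i (smulM L₀ d c x) = smulM L₀ d c (derM L₀ k i x)) ∧
      (∀ i : Fin d, derM L₀ k i (1 : M) = 0) ∧
      (∀ (i : Fin (d + 1)) (x y : M), derM' L₀ k i (x * y) =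
        ∑ j, ∑ l, smulM L₀ d (ε.repr (ε j * ε l) i) (derM' L₀ k j x * derM' L₀ k l y)) := by
  simp only [homAxioms, Theory.model_iff, Set.mem_union, or_imp, forall_and, Set.forall_mem_range,
    realize_allEq₁, realize_allEq₂, realize_smulT, realize_derT, realize_derT', realize_sumT,
    realize_addT, realize_mulT, realize_oneT, realize_zeroT, Prod.forall, and_assoc,
    forall_const]
  rfl

/-- The axioms of `𝒟`-fields say exactly that the scalar multiplication makes the field `M` a
`k`-algebra for which `a ↦ a ⊗ ε₀ + ∂₁ a ⊗ ε₁ + ⋯ + ∂_d a ⊗ ε_d` is a homomorphism of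
`k`-algebras from `M` to `M ⊗ 𝒟`. -/
theorem realize_dAxioms_iff (ε : Module.Basis (Fin (d + 1)) k D) (hε₀ : ε 0 = 1) :
    M ⊨ dAxioms φ ε ↔
      ∃ _ : Algebra k M, (∀ (c : k) (x : M), smulM L₀ d c x = c • x) ∧
        ∃ e : M →ₐ[k] M ⊗[k] D, ∀ a : M,
          e a = a ⊗ₜ[k] ε 0 + ∑ i : Fin d, derM L₀ k i a ⊗ₜ[k] ε i.succ := by
  have key (_ : Algebra k M) (f g : Fin (d + 1) → M) :
      (∑ i, f i ⊗ₜ[k] ε i) * (∑ i, g i ⊗ₜ[k] ε i) =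
        ∑ i, (∑ j, ∑ l, ε.repr (ε j * ε l) i • (f j * g l)) ⊗ₜ[k] ε i := by
    have h1 (x : M) (y : D) : x ⊗ₜ[k] y = ∑ i, (ε.repr y i • x) ⊗ₜ[k] ε i := by
      conv_lhs => rw [← ε.sum_repr y, TensorProduct.tmul_sum]
      simp only [TensorProduct.smul_tmul]
    simp only [Finset.sum_mul_sum, Algebra.TensorProduct.tmul_mul_tmul, TensorProduct.sum_tmul]
    rw [Finset.sum_comm (t := Finset.univ) (f := fun i j => ∑ l,
      (ε.repr (ε j * ε l) i • (f j * g l)) ⊗ₜ[k] ε i)]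
    refine Finset.sum_congr rfl fun j _ => ?_
    rw [Finset.sum_comm (f := fun i l => (ε.repr (ε j * ε l) i • (f j * g l)) ⊗ₜ[k] ε i)]
    exact Finset.sum_congr rfl fun l _ => h1 _ _
  have inj (_ : Algebra k M) (f g : Fin (d + 1) → M)
      (h : ∑ i, f i ⊗ₜ[k] ε i = ∑ i, g i ⊗ₜ[k] ε i) : f = g := by
    have h2 (f : Fin (d + 1) → M) : ∑ i, f i ⊗ₜ[k] ε i =
        ∑ i, f i • Algebra.TensorProduct.basis M ε i := by
      simp [TensorProduct.smul_tmul']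
    rw [h2, h2, ← Module.Basis.equivFun_symm_apply, ← Module.Basis.equivFun_symm_apply] at h
    exact (Algebra.TensorProduct.basis M ε).equivFun.symm.injective h
  have sum_eq (_ : Algebra k M) (a : M) :
      a ⊗ₜ[k] ε 0 + ∑ i : Fin d, derM L₀ k i a ⊗ₜ[k] ε i.succ =
        ∑ i, derM' L₀ k i a ⊗ₜ[k] ε i := by
    rw [Fin.sum_univ_succ]; rfl
  have derM'_succ (i : Fin d) (a : M) : derM' L₀ k i.succ a = derM L₀ k i a := rfl
  rw [dAxioms, Theory.model_union_iff, realize_kAlgAxioms, realize_homAxioms]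
  constructor
  · rintro ⟨⟨a1, a2, a3, a4, a5⟩, b1, b2, b3, b4⟩
    let smulInst : SMul k M := ⟨fun c x => smulM L₀ d c x⟩
    let modInst : Module k M := Module.ofMinimalAxioms a1 a2 a3 a4
    let alg : Algebra k M := Algebra.ofModule (fun c x y => (a5 c x y).symm) (fun c x y => by
      change x * smulM L₀ d c y = smulM L₀ d c (x * y)
      rw [mul_comm x, ← a5, mul_comm x])
    refine ⟨alg, fun _ _ => rfl, AlgHom.ofLinearMap
      { toFun := fun a => ∑ i, derM' L₀ k i a ⊗ₜ[k] ε i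
        map_add' := fun x y => ?_
        map_smul' := fun c x => ?_ } ?_ ?_, fun a => (sum_eq alg a).symm⟩
    · rw [← Finset.sum_add_distrib]
      refine Finset.sum_congr rfl fun i _ => ?_
      rw [← TensorProduct.add_tmul]
      congr 1
      exact Fin.cases rfl (fun j => b1 j x y) i
    · rw [Finset.smul_sum]
      refine Finset.sum_congr rfl fun i _ => ?_
      rw [TensorProduct.smul_tmul']
      congr 1
      exact Fin.cases rfl (fun j => b2 j c x) i
    · change ∑ i, derM' L₀ k i (1 : M) ⊗ₜ[k] ε i = 1
      rw [Fin.sum_univ_succ]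
      simp only [derM'_succ, b3, TensorProduct.zero_tmul, Finset.sum_const_zero, add_zero, hε₀]
      rfl
    · intro x y
      refine Eq.trans ?_ (key alg (fun i => derM' L₀ k i x) (fun i => derM' L₀ k i y)).symm
      change ∑ i, derM' L₀ k i (x * y) ⊗ₜ[k] ε i = _
      exact Finset.sum_congr rfl fun i _ => congrArg (· ⊗ₜ[k] ε i) (b4 i x y)
  · rintro ⟨alg, h, e, he⟩
    simp only [h]
    simp only [sum_eq] at he
    have hadd (x y : M) := inj alg (fun i => derM' L₀ k i (x + y))
      (fun i => derM' L₀ k i x + derM' L₀ k i y) (by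
        simp only [TensorProduct.add_tmul, Finset.sum_add_distrib, ← he, map_add])
    have hsmul (c : k) (x : M) := inj alg (fun i => derM' L₀ k i (c • x))
      (fun i => c • derM' L₀ k i x) (by
        simp only [← TensorProduct.smul_tmul', ← Finset.smul_sum, ← he, map_smul])
    have hone := inj alg (fun i => derM' L₀ k i (1 : M)) (fun i => Fin.cases 1 (fun _ => 0) i) (by
        rw [← he, map_one, Fin.sum_univ_succ]
        simp [hε₀, Algebra.TensorProduct.one_def])
    have hmul (x y : M) := inj alg (fun i => derM' L₀ k i (x * y))
      (fun i => ∑ j, ∑ l, ε.repr (ε j * ε l) i • (derM' L₀ k j x * derM' L₀ k l y)) (by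
        rw [← he, map_mul, he, he, key])
    refine ⟨⟨fun c x y => smul_add c x y, fun c c' x => add_smul c c' x,
      fun c c' x => mul_smul c c' x, fun x => one_smul k x,
      fun c x y => (smul_mul_assoc c x y).symm⟩,
      fun i x y => congrFun (hadd x y) i.succ, fun i c x => congrFun (hsmul c x) i.succ,
      fun i => congrFun hone i.succ, fun i x y => congrFun (hmul x y) i⟩

end Semantics

end DerivLike

open DerivLike

/-! A `𝒟`-field structure on `K` is a `k`-algebra section `K → K ⊗ 𝒟` of the residue map `K ⊗ 𝒟 →
K`. As `𝒟` is local and finite-dimensional with residue field `k`, the kernel of this map is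
nilpotent, so everything is a question of lifting homomorphisms along a nilpotent ideal. In
characteristic zero such lifts are unique on algebraic extensions (Newton's lemma for minimal
polynomials) and can be prescribed arbitrarily on a transcendence basis.

Amalgamation takes place on `U` itself. Let `r` be a transcendence basis of `A` over `C`. By
algebraic disjointness it stays independent over `B`, so it extends to a transcendence basis `s` of
`U` over `B`. Extend the section of `B` to `U` with the values prescribed by `A` on `r` and the
constants `x ⊗ 1` on `s \ r`. The result agrees with the section of `A` on `C ∪ r`, hence on `A` by
uniqueness (`exists_common_extension`).

Commutation of the operators says that the iterate `U → U ⊗ 𝒟 ⊗ 𝒟` is fixed by the exchange of the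
two copies of `𝒟`. The iterate and its exchange are homomorphisms with the same residue, and they
agree on `A`, `B` and `s \ r`, so they agree everywhere by uniqueness (`exists_section_extension`).

For condition (ii), compositums and slimness make every element of the intermediate structure
algebraic over the field generated by `A ∪ B`. Uniqueness of lifts then gives uniqueness of the
structure, and Newton's lemma inside the elements of `U ⊗ 𝒟` with coordinates in that structure
gives closure under the operators (`tensorCoord_mem_of_isAlgebraic`, `exists_unique_expansion`). -/

namespace DerivLike

/-! ### Lifting homomorphisms of fields along nilpotent ideals. -/

section Lifting

variable {K F R : Type*} [Field K] [Field F] [CharZero K] [Algebra K F] [CommRing R]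

/-- This is the hypothesis of Newton's lemma. In characteristic zero minimal polynomials are
separable, so the derivative is nonzero at `x`, hence a unit of the field `F`, and `f` preserves
units. -/
theorem isUnit_aeval_derivative_minpoly [Algebra K R] (f : F →ₐ[K] R) {x : F}
    (hx : IsAlgebraic K x) :
    IsUnit (Polynomial.aeval (f x) (Polynomial.derivative (minpoly K x))) := by
  rw [Polynomial.aeval_algHom_apply]
  refine (IsUnit.mk0 _ ?_).map f
  exact (minpoly.irreducible hx.isIntegral).separable.aeval_derivative_ne_zero (minpoly.aeval K x)

/-- Two homomorphisms that agree up to nilpotents agree on algebraic elements. -/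
theorem algHom_eq_of_isNilpotent_sub [Algebra K R] (f g : F →ₐ[K] R) {x : F}
    (hx : IsAlgebraic K x) (h : IsNilpotent (f x - g x)) : f x = g x := by
  have root (e : F →ₐ[K] R) : Polynomial.aeval (e x) (minpoly K x) = 0 := by
    rw [Polynomial.aeval_algHom_apply, minpoly.aeval, map_zero]
  -- Both `f x` and `g x` are roots of the minimal polynomial that differ from `f x` by a nilpotent,
  -- and Newton's lemma allows only one.
  refine (Polynomial.existsUnique_nilpotent_sub_and_aeval_eq_zero (P := minpoly K x) (x := f x)
    (by simp [root]) (isUnit_aeval_derivative_minpoly f hx)).unique ⟨?_, root f⟩ ⟨h, root g⟩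
  simp

theorem ringHom_eq_of_isNilpotent_sub (f g : F →+* R)
    (hK : ∀ c : K, f (algebraMap K F c) = g (algebraMap K F c)) {x : F}
    (hx : IsAlgebraic K x) (h : IsNilpotent (f x - g x)) : f x = g x := by
  -- `R` becomes a `K`-algebra through `f`; by `hK` the map `g` is then `K`-linear too.
  let : Algebra K R := (f.comp (algebraMap K F)).toAlgebra
  exact algHom_eq_of_isNilpotent_sub (K := K) ⟨f, fun _ => rfl⟩ ⟨g, fun c => (hK c).symm⟩ hx h

/-- The values of a homomorphism at algebraic elements stay in a subring in which they can be
approximated up to nilpotents. -/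
theorem ringHom_mem_of_isNilpotent_sub (f : F →+* R) (S : Subring R)
    (hS : ∀ s ∈ S, IsUnit s → ∃ t ∈ S, s * t = 1)
    (hK : ∀ c : K, f (algebraMap K F c) ∈ S) {x : F} (hx : IsAlgebraic K x)
    {y : R} (hy : y ∈ S) (h : IsNilpotent (y - f x)) : f x ∈ S := by
  let : Algebra K R := (f.comp (algebraMap K F)).toAlgebra
  let f' : F →ₐ[K] R := ⟨f, fun _ => rfl⟩
  let S' : Subalgebra K R := { S with algebraMap_mem' := hK }
  let y' : S' := ⟨y, hy⟩
  have hval (p : Polynomial K) : ((Polynomial.aeval y' p : S') : R) = Polynomial.aeval y p :=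
    (Polynomial.aeval_algHom_apply S'.val y' p).symm
  have root : Polynomial.aeval (f x) (minpoly K x) = 0 := by
    change Polynomial.aeval (f' x) (minpoly K x) = 0
    rw [Polynomial.aeval_algHom_apply, minpoly.aeval, map_zero]
  -- `y` is an approximate root because it is close to the true root `f x`. Newton's lemma is run
  -- inside `S'`, where `hS` supplies the inverse of the derivative; uniqueness in `R` identifies
  -- the root found with `f x`.
  have hnil : IsNilpotent (Polynomial.aeval y' (minpoly K x)) := by
    obtain ⟨n, hn⟩ := Polynomial.isNilpotent_aeval_sub_of_isNilpotent_sub (minpoly K x) h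
    refine ⟨n, Subtype.ext ?_⟩
    rw [root, sub_zero] at hn
    simpa [hval] using hn
  have hunit' : IsUnit (Polynomial.aeval y (Polynomial.derivative (minpoly K x))) :=
    Polynomial.isUnit_aeval_of_isUnit_aeval_of_isNilpotent_sub
      (isUnit_aeval_derivative_minpoly f' hx) h
  have hunit : IsUnit (Polynomial.aeval y' (Polynomial.derivative (minpoly K x))) := by
    obtain ⟨t, ht, hst⟩ := hS _ (hval _ ▸ (Polynomial.aeval y' _ : S').2) hunit'
    refine IsUnit.of_mul_eq_one ⟨t, ht⟩ (Subtype.ext ?_)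
    simpa [hval] using hst
  obtain ⟨r, ⟨hr, hr'⟩, -⟩ := Polynomial.existsUnique_nilpotent_sub_and_aeval_eq_zero hnil hunit
  have hr1 : IsNilpotent (y - (r : R)) := hr.map S'.val
  have hr2 : Polynomial.aeval (r : R) (minpoly K x) = 0 := by
    rw [show (r : R) = S'.val r from rfl, Polynomial.aeval_algHom_apply, hr', map_zero]
  have : (r : R) = f x :=
    (Polynomial.existsUnique_nilpotent_sub_and_aeval_eq_zero (P := minpoly K x) (x := y)
      (by simpa [hval] using hnil.map S'.val) hunit').unique ⟨hr1, hr2⟩ ⟨h, root⟩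
  exact this ▸ r.2

/-- A homomorphism on `K` and values on a transcendence basis extend to a section of a map with
nilpotent kernel. -/
theorem exists_section_of_isTranscendenceBasis (π : R →+* F) (hπ : Function.Surjective π)
    (hker : IsNilpotent (RingHom.ker π)) (e : K →+* R)
    (he : ∀ c, π (e c) = algebraMap K F c) {s : Set F}
    (hs : IsTranscendenceBasis K ((↑) : s → F)) (v : s → R) (hv : ∀ i, π (v i) = i) :
    ∃ f : F →+* R, (∀ x, π (f x) = x) ∧ (∀ c, f (algebraMap K F c) = e c) ∧ ∀ i : s, f i = v i := by
  -- `F` is separable algebraic over the fraction field of `K[s]`, hence formally smooth over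
  -- `K[s]`. Making `R` a `K[s]`-algebra by `e` and `v` turns the desired section into a lift of the
  -- identity of `F`.
  let algPF : Algebra (MvPolynomial s K) F :=
    (MvPolynomial.aeval ((↑) : s → F)).toRingHom.toAlgebra
  have hinj : Function.Injective (algebraMap (MvPolynomial s K) F) := hs.1
  have : FaithfulSMul (MvPolynomial s K) F := (faithfulSMul_iff_algebraMap_injective _ _).2 hinj
  have : Algebra.IsAlgebraic (MvPolynomial s K) F := by
    have h1 := hs.isAlgebraic
    refine ⟨fun x => ?_⟩
    have h2 := h1.isAlgebraic x
    refine IsAlgebraic.of_ringHom_of_comp_eq hs.1.aevalEquiv (RingHom.id F) h2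
      hs.1.aevalEquiv.surjective Function.injective_id ?_
    ext p <;> simp [RingHom.algebraMap_toAlgebra]
  let algQF : Algebra (FractionRing (MvPolynomial s K)) F := FractionRing.liftAlgebra _ _
  have : Algebra.IsAlgebraic (FractionRing (MvPolynomial s K)) F :=
    (IsFractionRing.comap_isAlgebraic_iff (A := MvPolynomial s K)).1 inferInstance
  have : Algebra.FormallySmooth (FractionRing (MvPolynomial s K)) F :=
    have := Algebra.FormallyEtale.of_isSeparable (FractionRing (MvPolynomial s K)) F
    inferInstance
  have : Algebra.FormallyEtale (MvPolynomial s K) (FractionRing (MvPolynomial s K)) :=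
    Algebra.FormallyEtale.of_isLocalization (nonZeroDivisors _)
  have : Algebra.FormallySmooth (MvPolynomial s K) F :=
    .comp _ (FractionRing (MvPolynomial s K)) _
  let algPR : Algebra (MvPolynomial s K) R := (MvPolynomial.eval₂Hom e v).toAlgebra
  have hcomm : π.comp (MvPolynomial.eval₂Hom e v) = algebraMap (MvPolynomial s K) F := by
    refine MvPolynomial.ringHom_ext (fun c => ?_) fun i => ?_
    · simp [he, RingHom.algebraMap_toAlgebra]
    · simp [hv, RingHom.algebraMap_toAlgebra]
  let π' : R →ₐ[MvPolynomial s K] F := ⟨π, fun p => DFunLike.congr_fun hcomm p⟩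
  let f := Algebra.FormallySmooth.liftOfSurjective (AlgHom.id (MvPolynomial s K) F) π' hπ hker
  refine ⟨f, fun x => ?_, fun c => ?_, fun i => ?_⟩
  · exact Algebra.FormallySmooth.liftOfSurjective_apply (AlgHom.id (MvPolynomial s K) F) π' hπ
      hker x
  · have h := f.commutes (MvPolynomial.C c)
    simpa [RingHom.algebraMap_toAlgebra] using h
  · have h := f.commutes (MvPolynomial.X i)
    simpa [RingHom.algebraMap_toAlgebra] using h

end Lifting

/-! ### Homomorphisms on subfields and their common extensions. -/

section SubfieldLifting

variable {U R : Type*} [Field U] [CharZero U] [CommRing R]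

/-- Two homomorphisms on a subfield that agree on a set `t` and agree up to nilpotents everywhere
agree at all elements algebraic over the subfield generated by `t`. -/
theorem subfieldHom_eq_of_isNilpotent_sub {F : Subfield U} (f g : F →+* R) {t : Set U}
    (ht : t ⊆ F) (hfg : ∀ x (h : x ∈ t), f ⟨x, ht h⟩ = g ⟨x, ht h⟩) (x : F)
    (hx : IsAlgebraic (Subfield.closure t) (x : U)) (h : IsNilpotent (f x - g x)) :
    f x = g x := by
  -- Homomorphisms from a field agree on a subfield, so agreement on `t` spreads to the subfield it
  -- generates.
  have hle : Subfield.closure t ≤ (f.eqLocusField g).map F.subtype :=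
    Subfield.closure_le.2 fun x hx => ⟨⟨x, ht hx⟩, hfg x hx, rfl⟩
  have hle' : Subfield.closure t ≤ F := Subfield.closure_le.2 ht
  let _ : Algebra (Subfield.closure t) F := (Subfield.inclusion hle').toAlgebra
  have : IsScalarTower (Subfield.closure t) F U := .of_algebraMap_eq fun _ => rfl
  refine ringHom_eq_of_isNilpotent_sub (K := Subfield.closure t) f g (fun c => ?_)
    ((isAlgebraic_algebraMap_iff (A := U) Subtype.val_injective).1 hx) h
  obtain ⟨y, hy, hyc⟩ := hle c.2
  rwa [show algebraMap (Subfield.closure t) F c = y from Subtype.ext hyc.symm]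

-- Transcendence bases give algebraicity over a subalgebra, while uniqueness of lifts is phrased
-- over a generated subfield.
omit [CharZero U] in
theorem isAlgebraic_closure_of_adjoin {B : Subfield U} {s : Set U} {x : U}
    (hx : IsAlgebraic (Algebra.adjoin B s) x) :
    IsAlgebraic (Subfield.closure ((B : Set U) ∪ s)) x := by
  have hle (y : Algebra.adjoin B s) : (y : U) ∈ Subfield.closure ((B : Set U) ∪ s) := by
    refine Algebra.adjoin_induction (p := fun y _ => y ∈ Subfield.closure ((B : Set U) ∪ s))
      (fun y hy => Subfield.subset_closure (.inr hy))
      (fun b => Subfield.subset_closure (.inl b.2))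
      (fun _ _ _ _ => add_mem) (fun _ _ _ _ => mul_mem) y.2
  exact hx.ringHom_of_comp_eq
    ((Algebra.adjoin B s).val.toRingHom.codRestrict (Subfield.closure ((B : Set U) ∪ s)) hle)
    (RingHom.id U) (fun a b h => Subtype.ext (congrArg (fun z : Subfield.closure ((B : Set U) ∪ s) => (z : U)) h)) rfl

/-- Sections over subfields `A` and `B` that agree on `C` have a common extension if `A` and `B`
are algebraically disjoint over `C`. It can be chosen to take given values on a set which together
with `A` and `B` generates a subfield over which everything is algebraic. -/
theorem exists_common_extension (π : R →+* U) (hker : IsNilpotent (RingHom.ker π))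
    (σ : U → R) (hσ : ∀ x, π (σ x) = x)
    {A B C : Subfield U} (hCA : C ≤ A) (hCB : C ≤ B) (eA : A →+* R) (eB : B →+* R)
    (hA : ∀ x, π (eA x) = x) (hB : ∀ x, π (eB x) = x)
    (hC : ∀ x (h : x ∈ C), eA ⟨x, hCA h⟩ = eB ⟨x, hCB h⟩)
    (hdisj : ∀ s : Set U, s ⊆ A → AlgebraicIndependent C ((↑) : s → U) →
      AlgebraicIndependent B ((↑) : s → U)) :
    ∃ e : U →+* R, (∀ x, π (e x) = x) ∧ (∀ x : A, e x = eA x) ∧ (∀ x : B, e x = eB x) ∧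
      ∃ t : Set U, (∀ x ∈ t, e x = σ x) ∧
        ∀ x : U, IsAlgebraic (Subfield.closure ((A : Set U) ∪ B ∪ t)) x := by
  have hnil {a b : R} (h : π a = π b) : IsNilpotent (a - b) := by
    obtain ⟨n, hn⟩ := hker
    refine ⟨n, ?_⟩
    have : (a - b) ^ n ∈ RingHom.ker π ^ n :=
      Ideal.pow_mem_pow (by rw [RingHom.mem_ker, map_sub, h, sub_self]) n
    simpa [hn] using this
  -- `r` is a transcendence basis of `A` over `C`, chosen as a set of elements of `U` so that it can
  -- be compared with `B`.
  obtain ⟨r, -, hr⟩ := exists_maximal_algebraicIndependent (R := C) (∅ : Set U) (A : Set U)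
    (Set.empty_subset _) ((algebraicIndependent_empty_type_iff ..).2
      (algebraMap C U).injective)
  obtain ⟨hrC, hrA⟩ := hr.prop
  have halgA (x : U) (hx : x ∈ A) : IsAlgebraic (Algebra.adjoin C r) x := by
    by_cases hxr : x ∈ r
    · exact isAlgebraic_algebraMap (⟨x, Algebra.subset_adjoin hxr⟩ : Algebra.adjoin C r)
    · by_contra hcon
      have h1 := (AlgebraicIndepOn.insert_iff (x := (id : U → U)) hxr).2
        ⟨hrC, by rw [Set.image_id]; exact hcon⟩
      exact hxr (hr.le_of_ge ⟨h1, Set.insert_subset hx hrA⟩ (Set.subset_insert x r)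
        (Set.mem_insert x r))
  -- Disjointness enters here: `r` is still independent over `B`.
  obtain ⟨s, hrs, hs⟩ := exists_isTranscendenceBasis_superset (R := B) (s := r) (hdisj r hrA hrC)
  classical
  let v : s → R := fun i => if h : (i : U) ∈ r then eA ⟨i, hrA h⟩ else σ i
  have hv (i : s) : π (v i) = i := by
    by_cases h : (i : U) ∈ r <;> simp [v, h, hA, hσ]
  obtain ⟨e, he, heB, hes⟩ := exists_section_of_isTranscendenceBasis π
    (fun x => ⟨σ x, hσ x⟩) hker eB hB hs v hv
  refine ⟨e, he, fun x => ?_, heB, s \ r, fun x hx => ?_, fun x => ?_⟩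
  · refine subfieldHom_eq_of_isNilpotent_sub (e.comp A.subtype) eA (t := (C : Set U) ∪ r)
      (Set.union_subset hCA hrA) ?_ x (isAlgebraic_closure_of_adjoin (halgA x x.2))
      (hnil (by simp [he, hA]))
    rintro y (hy | hy)
    · exact (heB ⟨y, hCB hy⟩).trans (hC y hy).symm
    · simpa [v, hy] using hes ⟨y, hrs hy⟩
  · simpa [v, hx.2] using hes ⟨x, hx.1⟩
  · have h1 : IsAlgebraic (Algebra.adjoin B s) x := by
      have := hs.isAlgebraic.isAlgebraic x
      rwa [Subtype.range_coe] at this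
    have hle : Subfield.closure ((B : Set U) ∪ s) ≤
        Subfield.closure ((A : Set U) ∪ B ∪ s \ r) := by
      refine Subfield.closure_mono ?_
      rintro y (hy | hy)
      · exact .inl (.inr hy)
      · by_cases hyr : y ∈ r
        · exact .inl (.inl (hrA hyr))
        · exact .inr ⟨hy, hyr⟩
    exact (isAlgebraic_closure_of_adjoin h1).ringHom_of_comp_eq (Subfield.inclusion hle)
      (RingHom.id U) (Subfield.inclusion hle).injective rfl

end SubfieldLifting

/-! ### The algebra `A ⊗ 𝒟`: residue map, coordinates, and the exchange of factors. -/

section Coordinates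

variable {k : Type*} [Field k] {D : Type*} [CommRing D] [Algebra k D] {d : ℕ}

/-- `𝒟` is finite over `k`, hence Artinian, so its maximal ideal is its Jacobson radical and is
nilpotent. -/
theorem exists_residue_algHom [IsLocalRing D]
    (hD : Function.Bijective (algebraMap k (IsLocalRing.ResidueField D)))
    (ε : Module.Basis (Fin (d + 1)) k D) (hε : ∀ i : Fin d, ε i.succ ∈ IsLocalRing.maximalIdeal D) :
    ∃ ρ : D →ₐ[k] k, IsNilpotent (RingHom.ker ρ) ∧ ∀ i : Fin d, ρ (ε i.succ) = 0 := by
  let e : k ≃ₐ[k] IsLocalRing.ResidueField D :=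
    AlgEquiv.ofBijective (Algebra.ofId k (IsLocalRing.ResidueField D)) hD
  let ρ : D →ₐ[k] k :=
    e.symm.toAlgHom.comp (IsScalarTower.toAlgHom k D (IsLocalRing.ResidueField D))
  have hρ (x : D) : ρ x = 0 ↔ x ∈ IsLocalRing.maximalIdeal D := by
    rw [← IsLocalRing.residue_eq_zero_iff]
    exact map_eq_zero_iff e.symm e.symm.injective
  refine ⟨ρ, ?_, fun i => (hρ _).2 (hε i)⟩
  have : Module.Finite k D := Module.Finite.of_basis ε
  have : IsArtinianRing D := IsArtinianRing.of_finite k D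
  have h : RingHom.ker ρ = (⊥ : Ideal D).jacobson := by
    rw [IsLocalRing.jacobson_eq_maximalIdeal _ bot_ne_top]
    ext x
    exact hρ x
  exact h ▸ IsArtinianRing.isNilpotent_jacobson_bot

variable (A : Type*) [CommRing A] [Algebra k A]

/-- The map `A ⊗ D → A` induced by a homomorphism `D → k`. -/
noncomputable def tensorResidue (ρ : D →ₐ[k] k) : A ⊗[k] D →ₐ[k] A :=
  (Algebra.TensorProduct.rid k k A).toAlgHom.comp
    (Algebra.TensorProduct.map (AlgHom.id k A) ρ)

variable {A}

theorem tensorResidue_tmul (ρ : D →ₐ[k] k) (a : A) (x : D) :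
    tensorResidue A ρ (a ⊗ₜ x) = ρ x • a := by
  simp [tensorResidue]

/-- By right exactness of the tensor product the kernel is the extension of `ker ρ` to `A ⊗ 𝒟`, and
extension of ideals commutes with powers. -/
theorem isNilpotent_ker_tensorResidue {ρ : D →ₐ[k] k} (hρ : IsNilpotent (RingHom.ker ρ)) :
    IsNilpotent (RingHom.ker (tensorResidue A ρ).toRingHom) := by
  have hsurj : Function.Surjective ρ := fun c => ⟨algebraMap k D c, by simp⟩
  have h : RingHom.ker (tensorResidue A ρ).toRingHom =
      (RingHom.ker ρ).map (Algebra.TensorProduct.includeRight : D →ₐ[k] A ⊗[k] D) := by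
    rw [← Algebra.TensorProduct.lTensor_ker ρ hsurj]
    ext x
    exact map_eq_zero_iff (Algebra.TensorProduct.rid k k A)
      (Algebra.TensorProduct.rid k k A).injective
  obtain ⟨n, hn⟩ := hρ
  refine ⟨n, ?_⟩
  rw [h, ← Ideal.map_pow, hn]
  exact Ideal.map_bot

variable (ε : Module.Basis (Fin (d + 1)) k D)

/-- The coordinates of elements of `A ⊗ D` with respect to a basis of `D`. -/
noncomputable def tensorCoord (i : Fin (d + 1)) : A ⊗[k] D →ₗ[A] A :=
  (Algebra.TensorProduct.basis A ε).coord i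

theorem tensorCoord_tmul (i : Fin (d + 1)) (a : A) (x : D) :
    tensorCoord ε i (a ⊗ₜ[k] x) = ε.repr x i • a := by
  simp [tensorCoord, Algebra.TensorProduct.basis_repr_tmul, Algebra.smul_def, mul_comm]

theorem sum_tensorCoord (x : A ⊗[k] D) : ∑ i, tensorCoord ε i x ⊗ₜ[k] ε i = x := by
  conv_rhs => rw [← (Algebra.TensorProduct.basis A ε).sum_repr x]
  refine Finset.sum_congr rfl fun i _ => ?_
  simp [tensorCoord, TensorProduct.smul_tmul']

theorem tensorCoord_sum (c : Fin (d + 1) → A) (i : Fin (d + 1)) :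
    tensorCoord ε i (∑ j, c j ⊗ₜ[k] ε j) = c i := by
  simp [tensorCoord_tmul, Finsupp.single_apply]

theorem tensorCoord_ext {x y : A ⊗[k] D} (h : ∀ i, tensorCoord ε i x = tensorCoord ε i y) :
    x = y := by
  rw [← sum_tensorCoord ε x, ← sum_tensorCoord ε y]
  simp only [h]

theorem tensorCoord_zero_eq {ρ : D →ₐ[k] k} (hε₀ : ε 0 = 1) (hρ : ∀ i : Fin d, ρ (ε i.succ) = 0)
    (x : A ⊗[k] D) : tensorCoord ε 0 x = tensorResidue A ρ x := by
  conv_rhs => rw [← sum_tensorCoord ε x]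
  simp [Fin.sum_univ_succ, tensorResidue_tmul, hρ, hε₀]

/-- The elements of `U ⊗ D` with coordinates in a subfield `K` of `U`. -/
theorem exists_coordSubring {U : Type*} [Field U] [Algebra k U] (K : Subfield U)
    (hk : ∀ c, algebraMap k U c ∈ K) :
    ∃ S : Subring (U ⊗[k] D), ∀ x, x ∈ S ↔ ∀ i, tensorCoord ε i x ∈ K := by
  let K' : Subalgebra k U := { K with algebraMap_mem' := hk }
  -- As the image of `K ⊗ 𝒟` in `U ⊗ 𝒟` it is a subring for free.
  refine ⟨(Algebra.TensorProduct.map K'.val (AlgHom.id k D)).range.toSubring, fun x => ⟨?_, ?_⟩⟩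
  · rintro ⟨y, rfl⟩ i
    induction y using TensorProduct.induction_on with
    | zero => simp
    | add y z hy hz => simpa using add_mem hy hz
    | tmul a b =>
      have : tensorCoord ε i ((a : U) ⊗ₜ[k] b) ∈ K := by
        rw [tensorCoord_tmul, Algebra.smul_def]
        exact mul_mem (hk _) a.2
      exact this
  · intro h
    rw [← sum_tensorCoord ε x]
    exact sum_mem fun i _ => ⟨(⟨_, h i⟩ : K') ⊗ₜ ε i, by simp⟩

/-- A section `e` of `A ⊗ D → A` has commuting coordinates at `x`. -/
def CommutesAt (e : A →ₐ[k] A ⊗[k] D) (x : A) : Prop :=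
  ∀ i j, tensorCoord ε i (e (tensorCoord ε j (e x))) = tensorCoord ε j (e (tensorCoord ε i (e x)))

/-- The exchange of the last two factors of `A ⊗ D ⊗ D`. -/
noncomputable def tensorSwap : (A ⊗[k] D) ⊗[k] D →ₐ[k] (A ⊗[k] D) ⊗[k] D :=
  ((Algebra.TensorProduct.assoc k k k A D D).symm.toAlgHom.comp
    (Algebra.TensorProduct.map (AlgHom.id k A) (Algebra.TensorProduct.comm k D D).toAlgHom)).comp
    (Algebra.TensorProduct.assoc k k k A D D).toAlgHom

theorem tensorSwap_tmul (a : A) (x y : D) :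
    tensorSwap ((a ⊗ₜ[k] x) ⊗ₜ[k] y) = (a ⊗ₜ[k] y) ⊗ₜ[k] x := by
  simp [tensorSwap]

/-- The iterate `A → A ⊗ D → A ⊗ D ⊗ D`. -/
noncomputable def tensorIterate (e : A →ₐ[k] A ⊗[k] D) : A →ₐ[k] (A ⊗[k] D) ⊗[k] D :=
  (Algebra.TensorProduct.map e (AlgHom.id k D)).comp e

/-- The last tensor factor records the operator applied first. -/
theorem tensorIterate_apply (e : A →ₐ[k] A ⊗[k] D) (x : A) :
    tensorIterate e x =
      ∑ j, ∑ i, (tensorCoord ε i (e (tensorCoord ε j (e x))) ⊗ₜ[k] ε i) ⊗ₜ[k] ε j := by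
  have h : tensorIterate e x = ∑ j, e (tensorCoord ε j (e x)) ⊗ₜ[k] ε j := by
    conv_lhs => rw [tensorIterate, AlgHom.comp_apply, ← sum_tensorCoord ε (e x), map_sum]
    simp
  rw [h]
  refine Finset.sum_congr rfl fun j _ => ?_
  rw [← TensorProduct.sum_tmul, sum_tensorCoord]

theorem tensorSwap_tensorIterate_apply (e : A →ₐ[k] A ⊗[k] D) (x : A) :
    tensorSwap (tensorIterate e x) =
      ∑ j, ∑ i, (tensorCoord ε j (e (tensorCoord ε i (e x))) ⊗ₜ[k] ε i) ⊗ₜ[k] ε j := by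
  rw [tensorIterate_apply ε]
  simp only [map_sum, tensorSwap_tmul]
  rw [Finset.sum_comm]

/-- Commutation becomes the equality of two ring homomorphisms at `x`, to which uniqueness of lifts
applies. -/
theorem commutesAt_iff (e : A →ₐ[k] A ⊗[k] D) (x : A) :
    CommutesAt ε e x ↔ tensorIterate e x = tensorSwap (tensorIterate e x) := by
  rw [tensorSwap_tensorIterate_apply ε, tensorIterate_apply ε]
  constructor
  · intro h
    refine Finset.sum_congr rfl fun j _ => Finset.sum_congr rfl fun i _ => ?_
    rw [h i j]
  · intro h i j
    simp only [← TensorProduct.sum_tmul] at h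
    have h1 := congrArg (fun z => tensorCoord ε i (tensorCoord ε j z)) h
    simpa only [tensorCoord_sum] using h1

end Coordinates

/-! ### Sections of the residue map: closure of subfields and extension to the whole field. -/

section Sections

variable {k : Type*} [Field k] {D : Type*} [CommRing D] [Algebra k D] {d : ℕ}
  {U : Type*} [Field U] [CharZero U] [Algebra k U] {ρ : D →ₐ[k] k}

theorem isNilpotent_sub_of_tensorResidue_eq {A : Type*} [CommRing A] [Algebra k A]
    (hρ : IsNilpotent (RingHom.ker ρ)) {x y : A ⊗[k] D}
    (h : tensorResidue A ρ x = tensorResidue A ρ y) : IsNilpotent (x - y) := by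
  obtain ⟨n, hn⟩ := isNilpotent_ker_tensorResidue (A := A) hρ
  refine ⟨n, ?_⟩
  rw [← Ideal.mem_bot, ← Ideal.zero_eq_bot, ← hn]
  refine Ideal.pow_mem_pow ?_ n
  rw [RingHom.mem_ker, map_sub, sub_eq_zero]
  exact h

variable (ε : Module.Basis (Fin (d + 1)) k D)

/-- A subfield algebraic over elements at which the coordinates of a section stay in the subfield
is closed under the coordinates of the section. -/
theorem tensorCoord_mem_of_isAlgebraic (hε₀ : ε 0 = 1) (hρ : IsNilpotent (RingHom.ker ρ))
    (hρε : ∀ i : Fin d, ρ (ε i.succ) = 0) {F K : Subfield U} (hKF : K ≤ F)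
    (hk : ∀ c, algebraMap k U c ∈ K) (e : F →+* U ⊗[k] D)
    (he : ∀ x, tensorResidue U ρ (e x) = x) {t : Set U} (ht : t ⊆ K)
    (het : ∀ x (h : x ∈ t) i, tensorCoord ε i (e ⟨x, hKF (ht h)⟩) ∈ K)
    (x : U) (hx : x ∈ K) (halg : IsAlgebraic (Subfield.closure t) x) (i : Fin (d + 1)) :
    tensorCoord ε i (e ⟨x, hKF hx⟩) ∈ K := by
  obtain ⟨S, hS⟩ := exists_coordSubring ε K hk
  have hmem {a : U} (ha : a ∈ K) : a ⊗ₜ[k] (1 : D) ∈ S := by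
    refine (hS _).2 fun i => ?_
    rw [tensorCoord_tmul, Algebra.smul_def]
    exact mul_mem (hk _) ha
  -- A unit `s` of `U ⊗ 𝒟` lying in `S` is `a ⊗ 1` plus a nilpotent of `S`, where `a` is its
  -- residue. As `a` is a nonzero element of the field `K`, `a ⊗ 1` is a unit of `S`, and so is `s`.
  have hinv : ∀ s ∈ S, IsUnit s → ∃ t ∈ S, s * t = 1 := by
    intro s hs hu
    have ha : tensorResidue U ρ s ∈ K := by
      rw [← tensorCoord_zero_eq ε hε₀ hρε]
      exact (hS s).1 hs 0
    set a := tensorResidue U ρ s with ha_def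
    have ha0 : a ≠ 0 := (hu.map (tensorResidue U ρ)).ne_zero
    have hu1 : IsUnit (⟨a ⊗ₜ[k] (1 : D), hmem ha⟩ : S) := by
      refine IsUnit.of_mul_eq_one ⟨a⁻¹ ⊗ₜ[k] (1 : D), hmem (inv_mem ha)⟩ (Subtype.ext ?_)
      simp [ha0, Algebra.TensorProduct.one_def]
    have hn : IsNilpotent (⟨s, hs⟩ - ⟨a ⊗ₜ[k] (1 : D), hmem ha⟩ : S) := by
      obtain ⟨n, hn⟩ := isNilpotent_sub_of_tensorResidue_eq hρ (x := s) (y := a ⊗ₜ[k] (1 : D))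
        (by simp [tensorResidue_tmul, ← ha_def])
      exact ⟨n, Subtype.ext (by simpa using hn)⟩
    have hu2 := hn.isUnit_add_left_of_commute hu1 (Commute.all _ _)
    rw [add_sub_cancel] at hu2
    obtain ⟨y, hy⟩ := hu2.exists_right_inv
    exact ⟨y, y.2, congrArg Subtype.val hy⟩
  have hle : Subfield.closure t ≤ F := Subfield.closure_le.2 (ht.trans hKF)
  have hclos (y : U) (hy : y ∈ Subfield.closure t) : ∃ h : y ∈ F, e ⟨y, h⟩ ∈ S := by
    induction hy using Subfield.closure_induction with
    | mem y hy => exact ⟨hKF (ht hy), (hS _).2 (het y hy)⟩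
    | one => exact ⟨one_mem F, (map_one e).symm ▸ S.one_mem⟩
    | add y z _ _ hy hz =>
      obtain ⟨hy, hy'⟩ := hy
      obtain ⟨hz, hz'⟩ := hz
      exact ⟨add_mem hy hz, (map_add e ⟨y, hy⟩ ⟨z, hz⟩).symm ▸ add_mem hy' hz'⟩
    | mul y z _ _ hy hz =>
      obtain ⟨hy, hy'⟩ := hy
      obtain ⟨hz, hz'⟩ := hz
      exact ⟨mul_mem hy hz, (map_mul e ⟨y, hy⟩ ⟨z, hz⟩).symm ▸ mul_mem hy' hz'⟩
    | neg y _ hy =>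
      obtain ⟨hy, hy'⟩ := hy
      exact ⟨neg_mem hy, (map_neg e ⟨y, hy⟩).symm ▸ neg_mem hy'⟩
    | inv y _ hy =>
      obtain ⟨hy, hy'⟩ := hy
      refine ⟨inv_mem hy, ?_⟩
      rcases eq_or_ne (⟨y, hy⟩ : F) 0 with h0 | h0
      · have : (⟨y⁻¹, inv_mem hy⟩ : F) = 0 := by
          rw [← inv_zero, ← h0]; rfl
        rw [this, map_zero]
        exact S.zero_mem
      · obtain ⟨z, hz, hyz⟩ := hinv _ hy' ((IsUnit.mk0 _ h0).map e)
        have h1 : e ⟨y, hy⟩ * e ⟨y⁻¹, inv_mem hy⟩ = 1 := by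
          rw [← map_mul, ← map_one e]
          exact congrArg e (mul_inv_cancel₀ h0)
        have : e ⟨y⁻¹, inv_mem hy⟩ = z := by
          rw [← one_mul z, ← h1, mul_right_comm, hyz, one_mul]
        exact this ▸ hz
  let _ : Algebra (Subfield.closure t) F := (Subfield.inclusion hle).toAlgebra
  have : IsScalarTower (Subfield.closure t) F U := .of_algebraMap_eq fun _ => rfl
  have halg' : IsAlgebraic (Subfield.closure t) (⟨x, hKF hx⟩ : F) :=
    (isAlgebraic_algebraMap_iff (A := U) Subtype.val_injective).1 halg
  -- The approximation to `e x` inside `S` is `x ⊗ 1`, which has the same residue.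
  refine (hS _).1 (ringHom_mem_of_isNilpotent_sub (K := Subfield.closure t) e S hinv (fun c => (hclos c c.2).2) halg'
    (hmem hx) (isNilpotent_sub_of_tensorResidue_eq hρ ?_)) i
  simp [he, tensorResidue_tmul]

/-- Sections over subfields `A` and `B` that agree on `C` extend to a section over the whole field
if `A` and `B` are algebraically disjoint over `C`, with commuting coordinates if the coordinates
commute on `A` and `B`. -/
theorem exists_section_extension (hε₀ : ε 0 = 1) (hρ : IsNilpotent (RingHom.ker ρ))
    (hρε : ∀ i : Fin d, ρ (ε i.succ) = 0)
    {A B C : Subfield U} (hCA : C ≤ A) (hCB : C ≤ B) (eA : A →+* U ⊗[k] D) (eB : B →+* U ⊗[k] D)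
    (hA : ∀ x, tensorResidue U ρ (eA x) = x) (hB : ∀ x, tensorResidue U ρ (eB x) = x)
    (hk : ∀ c, ∃ h : algebraMap k U c ∈ B, eB ⟨algebraMap k U c, h⟩ = algebraMap k _ c)
    (hC : ∀ x (h : x ∈ C), eA ⟨x, hCA h⟩ = eB ⟨x, hCB h⟩)
    (hdisj : ∀ s : Set U, s ⊆ A → AlgebraicIndependent C ((↑) : s → U) →
      AlgebraicIndependent B ((↑) : s → U)) :
    ∃ e : U →ₐ[k] U ⊗[k] D, (∀ x, tensorResidue U ρ (e x) = x) ∧ (∀ x : A, e x = eA x) ∧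
      (∀ x : B, e x = eB x) ∧
      ((∀ x ∈ A, CommutesAt ε e x) → (∀ x ∈ B, CommutesAt ε e x) → ∀ x, CommutesAt ε e x) := by
  obtain ⟨e, he, heA, heB, t, ht, halg⟩ := exists_common_extension (tensorResidue U ρ).toRingHom
    (isNilpotent_ker_tensorResidue hρ) (fun x => x ⊗ₜ[k] (1 : D))
    (fun x => by simp [tensorResidue_tmul]) hCA hCB eA eB hA hB hC hdisj
  let e' : U →ₐ[k] U ⊗[k] D := ⟨e, fun c => by
    obtain ⟨h, hc⟩ := hk c
    exact (heB ⟨_, h⟩).trans hc⟩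
  refine ⟨e', he, heA, heB, fun hcA hcB x => ?_⟩
  rw [commutesAt_iff]
  -- The residue kills the last factor only. Both sides are `e' y`, because coordinate `0` of `e'`
  -- is the identity.
  have hres (y : U) : tensorResidue (U ⊗[k] D) ρ (tensorIterate e' y) =
      tensorResidue (U ⊗[k] D) ρ (tensorSwap (tensorIterate e' y)) := by
    have h0 (z : U) : tensorCoord ε 0 (e' z) = z := by
      rw [tensorCoord_zero_eq ε hε₀ hρε]
      exact he z
    rw [← tensorCoord_zero_eq ε hε₀ hρε, ← tensorCoord_zero_eq ε hε₀ hρε,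
      tensorSwap_tensorIterate_apply ε, tensorIterate_apply ε]
    simp only [← TensorProduct.sum_tmul, tensorCoord_sum, h0]
  refine subfieldHom_eq_of_isNilpotent_sub (F := ⊤)
    ((tensorIterate e').toRingHom.comp (⊤ : Subfield U).subtype)
    (((tensorSwap.comp (tensorIterate e')).toRingHom).comp (⊤ : Subfield U).subtype)
    (t := (A : Set U) ∪ B ∪ t) (Set.subset_univ _) ?_ ⟨x, trivial⟩ (halg x) ?_
  · rintro y ((hy | hy) | hy)
    · exact (commutesAt_iff ε e' y).1 (hcA y hy)
    · exact (commutesAt_iff ε e' y).1 (hcB y hy)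
    -- On `t` the section is constant, so the iterate is `y ⊗ 1 ⊗ 1`.
    · change tensorIterate e' y = tensorSwap (tensorIterate e' y)
      have h1 : e' y = y ⊗ₜ[k] (1 : D) := ht y hy
      simp [tensorIterate, h1, tensorSwap_tmul]
  · exact isNilpotent_sub_of_tensorResidue_eq hρ (hres x)

end Sections

/-! ### Expansions of substructures by the new symbols, and universal axioms. -/

section Expansions

variable {L₀ : FirstOrder.Language.{u, v}} {k : Type u₁} {d : ℕ} {U : Type w} [L₀.Structure U]

/-- The expansion of a substructure by given interpretations of the new symbols. -/
def ExpSub.mk' (S : L₀.Substructure U) (s : k → S → S) (δ : Fin d → S → S) :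
    ExpSub (LHom.sumInl : L₀ →ᴸ dLang L₀ k d) U :=
  let _ : (opLang k d).Structure S :=
    { funMap := fun f => match f with
        | .smul c => fun x => s c (x 0)
        | .der i => fun x => δ i (x 0)
      RelMap := fun r => r.elim }
  ⟨S, inferInstance, inferInstance⟩

theorem ExpSub.funMap_inl (X : ExpSub (LHom.sumInl : L₀ →ᴸ dLang L₀ k d) U) {n : ℕ}
    (f : L₀.Functions n) (x : Fin n → X.carrier) :
    ((Structure.funMap (L := dLang L₀ k d) (Sum.inl f) x : X.carrier) : U) =
      Structure.funMap f fun i => (x i : U) :=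
  congrArg Subtype.val (X.isExpansion.map_onFunction f x)

theorem ExpSub.relMap_inl (X : ExpSub (LHom.sumInl : L₀ →ᴸ dLang L₀ k d) U) {n : ℕ}
    (r : L₀.Relations n) (x : Fin n → X.carrier) :
    Structure.RelMap (L := dLang L₀ k d) (Sum.inl r) x ↔
      Structure.RelMap r fun i => (x i : U) :=
  iff_of_eq (X.isExpansion.map_onRelation r x)

theorem ExpSub.funMap_smul (X : ExpSub (LHom.sumInl : L₀ →ᴸ dLang L₀ k d) U) (c : k)
    (x : Fin 1 → X.carrier) :
    Structure.funMap (L := dLang L₀ k d) (Sum.inr (OpFunc.smul c)) x = smulM L₀ d c (x 0) :=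
  congrArg _ (by ext i; fin_cases i; rfl)

theorem ExpSub.funMap_der (X : ExpSub (LHom.sumInl : L₀ →ᴸ dLang L₀ k d) U) (j : Fin d)
    (x : Fin 1 → X.carrier) :
    Structure.funMap (L := dLang L₀ k d) (Sum.inr (OpFunc.der j)) x = derM L₀ k j (x 0) :=
  congrArg _ (by ext i; fin_cases i; rfl)

/-- Both reducts are induced from `U`, so the symbols of `L₀` are preserved automatically. -/
theorem ExpSub.isSub_iff {X Y : ExpSub (LHom.sumInl : L₀ →ᴸ dLang L₀ k d) U} :
    X.IsSub Y ↔ ∃ h : X.carrier ≤ Y.carrier,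
      (∀ (c : k) (x : X.carrier),
        ((smulM L₀ d c (⟨x, h x.2⟩ : Y.carrier) : Y.carrier) : U) = (smulM L₀ d c x : X.carrier)) ∧
      ∀ (i : Fin d) (x : X.carrier),
        ((derM L₀ k i (⟨x, h x.2⟩ : Y.carrier) : Y.carrier) : U) = (derM L₀ k i x : X.carrier) := by
  constructor
  · rintro ⟨f, hf⟩
    have h : X.carrier ≤ Y.carrier := fun x hx => Set.mem_of_eq_of_mem (hf ⟨x, hx⟩).symm (f ⟨x, hx⟩).2
    have hfx (x : X.carrier) : f x = ⟨x, h x.2⟩ := Subtype.ext (hf x)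
    refine ⟨h, fun c x => ?_, fun i x => ?_⟩
    · refine Eq.trans ?_ (hf (smulM L₀ d c x))
      rw [smulM, smulM, f.map_fun]
      congr 2
      ext i; fin_cases i; exact (hf x).symm
    · refine Eq.trans ?_ (hf (derM L₀ k i x))
      rw [derM, derM, f.map_fun]
      congr 2
      ext i; fin_cases i; exact (hf x).symm
  · rintro ⟨h, hs, hd⟩
    refine ⟨⟨⟨fun x => ⟨x, h x.2⟩, fun x y hxy => Subtype.ext (Subtype.mk.inj hxy)⟩,
      ?_, ?_⟩, fun _ => rfl⟩
    · rintro n (f | f) x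
      · apply Subtype.ext
        exact (X.funMap_inl f x).trans (Y.funMap_inl f fun i => ⟨x i, h (x i).2⟩).symm
      · apply Subtype.ext
        cases f with
        | smul c =>
          rw [Y.funMap_smul]
          change ((Structure.funMap (L := dLang L₀ k d) (Sum.inr (OpFunc.smul c)) x : X.carrier) : U)
            = _
          rw [X.funMap_smul]
          exact (hs c (x 0)).symm
        | der i =>
          rw [Y.funMap_der]
          change ((Structure.funMap (L := dLang L₀ k d) (Sum.inr (OpFunc.der i)) x : X.carrier) : U)
            = _
          rw [X.funMap_der]
          exact (hd i (x 0)).symm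
    · rintro n (r | r) x
      · exact (Y.relMap_inl r fun i => ⟨x i, h (x i).2⟩).trans (X.relMap_inl r x).symm
      · exact r.elim

theorem ExpSub.eq_of_isSub {X Y : ExpSub (LHom.sumInl : L₀ →ᴸ dLang L₀ k d) U}
    (h : X.IsSub Y) (hc : X.carrier = Y.carrier) : X = Y := by
  obtain ⟨f, hf⟩ := h
  obtain ⟨S, strX, hX⟩ := X
  obtain ⟨S', strY, hY⟩ := Y
  obtain rfl : S = S' := hc
  have hfx (x : S) : f x = x := Subtype.ext (hf x)
  congr 1
  refine Structure.ext ?_ ?_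
  · funext n g x
    have h1 := @Embedding.map_fun _ _ _ strX strY f n g x
    rw [hfx] at h1
    refine h1.trans ?_
    congr 1
    funext i
    exact hfx (x i)
  · funext n r x
    have h1 := @Embedding.map_rel _ _ _ strX strY f n r x
    refine (propext h1).symm.trans ?_
    congr 1
    funext i
    exact hfx (x i)

/-- Universal sentences descend along embeddings. Nonemptiness is needed because entailment refers
to nonempty models. -/
theorem ExpSub.IsSub.models_univPart {X Y : ExpSub (LHom.sumInl : L₀ →ᴸ dLang L₀ k d) U}
    (h : X.IsSub Y) [Nonempty X.carrier] {T : (dLang L₀ k d).Theory} (hY : Y.Models T) :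
    X.Models (univPart T) := by
  obtain ⟨f, -⟩ := h
  have : Nonempty Y.carrier := ‹Nonempty X.carrier›.map f
  have : Y.carrier ⊨ T := hY
  refine (Theory.model_iff _).2 fun σ hσ => ?_
  refine hσ.1.realize_embedding f ?_
  have := hσ.2.realize_sentence Y.carrier
  rw [Sentence.Realize, Formula.Realize] at this
  convert! this

theorem isUniversal_allEq₁ (s t : (dLang L₀ k d).Term (Empty ⊕ Fin 1)) :
    (allEq₁ s t).IsUniversal :=
  (BoundedFormula.IsAtomic.equal s t).isUniversal.all

theorem isUniversal_allEq₂ (s t : (dLang L₀ k d).Term (Empty ⊕ Fin 2)) :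
    (allEq₂ s t).IsUniversal :=
  (BoundedFormula.IsAtomic.equal s t).isUniversal.all.all

/-- The axioms of `𝒟`-fields and of commutation are universal, so models of `univPart T` still
satisfy those that belong to `T`. -/
theorem ExpSub.Models.of_univPart {X : ExpSub (LHom.sumInl : L₀ →ᴸ dLang L₀ k d) U}
    {T T' : (dLang L₀ k d).Theory} (hX : X.Models (univPart T)) (hT : T' ⊆ T)
    (hT' : ∀ σ ∈ T', σ.IsUniversal) : X.Models T' :=
  (Theory.model_iff _).2 fun σ hσ =>
    (Theory.model_iff _).1 hX σ ⟨hT' σ hσ, Theory.models_sentence_of_mem (hT hσ)⟩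

theorem isUniversal_commAxioms : ∀ σ ∈ commAxioms L₀ k d, σ.IsUniversal := by
  rintro _ ⟨p, rfl⟩
  exact isUniversal_allEq₁ _ _

theorem realize_commAxioms {M : Type*} [(dLang L₀ k d).Structure M] :
    M ⊨ commAxioms L₀ k d ↔
      ∀ (i j : Fin d) (x : M), derM L₀ k i (derM L₀ k j x) = derM L₀ k j (derM L₀ k i x) := by
  simp only [commAxioms, Theory.model_iff, Set.forall_mem_range, realize_allEq₁, realize_derT,
    Prod.forall]
  rfl

theorem isUniversal_dAxioms (φ : fieldLang →ᴸ L₀) [Field k] {D : Type v₂} [CommRing D]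
    [Algebra k D] (ε : Module.Basis (Fin (d + 1)) k D) : ∀ σ ∈ dAxioms φ ε, σ.IsUniversal := by
  simp only [dAxioms, kAlgAxioms, homAxioms, Set.mem_union, or_imp, forall_and,
    Set.forall_mem_range, Set.mem_singleton_iff, forall_eq, isUniversal_allEq₁, isUniversal_allEq₂,
    implies_true, and_self]

end Expansions

/-! ### Substructures as subfields. -/

section FieldStructure

variable {L₀ : FirstOrder.Language.{u, v}} (φ : fieldLang →ᴸ L₀) {U : Type w} [L₀.Structure U]
  [Field U] [φ.IsExpansionOn U]

/-- A substructure of a field, in a language expanding the language of fields, is a subfield. -/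
def subfieldOf (S : L₀.Substructure U) : Subfield U where
  carrier := S
  mul_mem' {a b} ha hb :=
    Set.mem_of_eq_of_mem
      (φ.map_onFunction (M := U) (FieldFunc.mul : fieldLang.Functions 2) ![a, b]).symm
      (S.fun_mem _ ![a, b] (by intro i; fin_cases i <;> assumption))
  one_mem' :=
    Set.mem_of_eq_of_mem
      (φ.map_onFunction (M := U) (FieldFunc.one : fieldLang.Functions 0) ![]).symm
      (S.fun_mem _ ![] finZeroElim)
  add_mem' {a b} ha hb :=
    Set.mem_of_eq_of_mem
      (φ.map_onFunction (M := U) (FieldFunc.add : fieldLang.Functions 2) ![a, b]).symm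
      (S.fun_mem _ ![a, b] (by intro i; fin_cases i <;> assumption))
  zero_mem' :=
    Set.mem_of_eq_of_mem
      (φ.map_onFunction (M := U) (FieldFunc.zero : fieldLang.Functions 0) ![]).symm
      (S.fun_mem _ ![] finZeroElim)
  neg_mem' {a} ha :=
    Set.mem_of_eq_of_mem
      (φ.map_onFunction (M := U) (FieldFunc.neg : fieldLang.Functions 1) ![a]).symm
      (S.fun_mem _ ![a] (by intro i; fin_cases i; assumption))
  inv_mem' a ha :=
    Set.mem_of_eq_of_mem
      (φ.map_onFunction (M := U) (FieldFunc.inv : fieldLang.Functions 1) ![a]).symm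
      (S.fun_mem _ ![a] (by intro i; fin_cases i; assumption))

/-- The field structure on a substructure. -/
abbrev substructureField (S : L₀.Substructure U) : Field S :=
  inferInstanceAs (Field (subfieldOf φ S))

variable {k : Type u₁} {d : ℕ}

theorem isExpansionOn_carrier (X : ExpSub (LHom.sumInl : L₀ →ᴸ dLang L₀ k d) U) :
    let _ := substructureField φ X.carrier
    ((LHom.sumInl : L₀ →ᴸ dLang L₀ k d).comp φ).IsExpansionOn X.carrier := by
  intro _
  refine ⟨fun {n} f x => Subtype.ext ?_, fun r => r.elim⟩
  refine (X.funMap_inl (φ.onFunction f) x).trans ?_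
  rw [φ.map_onFunction]
  cases f <;> rfl

end FieldStructure

/-! ### Translation between expansions and sections into `U ⊗ 𝒟`. -/

section Bridge

variable {L₀ : FirstOrder.Language.{u, v}} (φ : fieldLang →ᴸ L₀) {U : Type w} [L₀.Structure U]
  [Field U] [φ.IsExpansionOn U] {k : Type u₁} [Field k] {D : Type v₂} [CommRing D] [Algebra k D]
  {d : ℕ} (ε : Module.Basis (Fin (d + 1)) k D)

/-- The scalar `c` acts as multiplication by `c • 1`. The monster model carries no `k`-algebra
structure of its own, and `g` provides one. -/
theorem exists_scalarHom (hε₀ : ε 0 = 1) {X : ExpSub (LHom.sumInl : L₀ →ᴸ dLang L₀ k d) U}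
    (hX : X.Models (dAxioms φ ε)) :
    ∃ g : k →+* U, ∀ (c : k) (x : X.carrier), ((smulM L₀ d c x : X.carrier) : U) = g c * x := by
  let _ := substructureField φ X.carrier
  have := isExpansionOn_carrier φ X
  obtain ⟨alg, h, -⟩ := (realize_dAxioms_iff ε hε₀).1 hX
  refine ⟨(subfieldOf φ X.carrier).subtype.comp (algebraMap k X.carrier), fun c x => ?_⟩
  rw [h, Algebra.smul_def]
  rfl

/-- The scalar multiplication of `X` is that of the `k`-algebra `U`. -/
def ExpSub.Compatible [Algebra k U] (X : ExpSub (LHom.sumInl : L₀ →ᴸ dLang L₀ k d) U) : Prop :=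
  ∀ (c : k) (x : X.carrier), ((smulM L₀ d c x : X.carrier) : U) = algebraMap k U c * x

variable [Algebra k U]

/-- The target is `U ⊗ 𝒟` rather than `X ⊗ 𝒟`, so that the sections of different structures can be
compared in one ring. -/
theorem exists_sectionHom (hε₀ : ε 0 = 1) {X : ExpSub (LHom.sumInl : L₀ →ᴸ dLang L₀ k d) U}
    (hX : X.Models (dAxioms φ ε)) (hc : X.Compatible) :
    ∃ e : subfieldOf φ X.carrier →+* U ⊗[k] D,
      (∀ (x : U) (hx : x ∈ X.carrier) (i : Fin (d + 1)),
        tensorCoord ε i (e ⟨x, hx⟩) = (derM' L₀ k i (⟨x, hx⟩ : X.carrier) : X.carrier)) ∧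
      ∀ c, ∃ h : algebraMap k U c ∈ subfieldOf φ X.carrier,
        e ⟨algebraMap k U c, h⟩ = algebraMap k (U ⊗[k] D) c := by
  let _ := substructureField φ X.carrier
  have := isExpansionOn_carrier φ X
  obtain ⟨alg, h, e, he⟩ := (realize_dAxioms_iff ε hε₀).1 hX
  let ι : X.carrier →ₐ[k] U := ⟨(subfieldOf φ X.carrier).subtype, fun c => by
    have h1 := hc c 1
    rw [h, ← Algebra.algebraMap_eq_smul_one] at h1
    refine h1.trans ?_
    exact mul_one _⟩
  refine ⟨((Algebra.TensorProduct.map ι (AlgHom.id k D)).comp e).toRingHom,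
    fun x hx i => ?_, fun c => ⟨ι.commutes c ▸ (algebraMap k X.carrier c).2, ?_⟩⟩
  swap
  · refine Eq.trans ?_
      (((Algebra.TensorProduct.map ι (AlgHom.id k D)).comp e).commutes c)
    refine congrArg ((Algebra.TensorProduct.map ι (AlgHom.id k D)).comp e) (Subtype.ext ?_)
    exact (ι.commutes c).symm
  change tensorCoord ε i (Algebra.TensorProduct.map ι (AlgHom.id k D) (e ⟨x, hx⟩)) = _
  have hs : Algebra.TensorProduct.map ι (AlgHom.id k D) (e ⟨x, hx⟩) =
      ∑ j, ((derM' L₀ k j (⟨x, hx⟩ : X.carrier) : X.carrier) : U) ⊗ₜ[k] ε j := by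
    rw [he, Fin.sum_univ_succ, map_add, map_sum]
    rfl
  rw [hs, tensorCoord_sum]

/-- Taking all of `U` as carrier makes `T₀` hold for free; only the `𝒟`-field axioms remain, and the
section encodes them. -/
theorem exists_expSub_top {T₀ : L₀.Theory} (hT₀ : U ⊨ T₀) (hε₀ : ε 0 = 1) {e : U →ₐ[k] U ⊗[k] D}
    (he : ∀ x, tensorCoord ε 0 (e x) = x) :
    ∃ M : ExpSub (LHom.sumInl : L₀ →ᴸ dLang L₀ k d) U, M.carrier = ⊤ ∧
      M.Models (theoryD φ T₀ ε) ∧ M.Compatible ∧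
      ∀ (i : Fin d) (x : M.carrier),
        ((derM L₀ k i x : M.carrier) : U) = tensorCoord ε i.succ (e x) := by
  let M : ExpSub (LHom.sumInl : L₀ →ᴸ dLang L₀ k d) U := ExpSub.mk' ⊤
    (fun c x => ⟨algebraMap k U c * x, trivial⟩)
    (fun i x => ⟨tensorCoord ε i.succ (e x), trivial⟩)
  refine ⟨M, rfl, ?_, fun _ _ => rfl, fun _ _ => rfl⟩
  refine Theory.model_union_iff.2 ⟨?_, ?_⟩
  · have hM := M.isExpansion
    refine (LHom.onTheory_model (LHom.sumInl : L₀ →ᴸ dLang L₀ k d) T₀).2 ?_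
    exact (StrongHomClass.theory_model (Substructure.topEquiv (L := L₀) (M := U)).symm : _ ⊨ T₀)
  · let _ := substructureField φ M.carrier
    have := isExpansionOn_carrier φ M
    let ι : M.carrier ≃+* U :=
      { toFun := fun x => x
        invFun := fun x => ⟨x, trivial⟩
        left_inv := fun _ => rfl
        right_inv := fun _ => rfl
        map_mul' := fun _ _ => rfl
        map_add' := fun _ _ => rfl }
    let _ : Algebra k M.carrier := (ι.symm.toRingHom.comp (algebraMap k U)).toAlgebra
    let ι' : M.carrier ≃ₐ[k] U := AlgEquiv.ofRingEquiv (f := ι) fun _ => rfl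
    refine (realize_dAxioms_iff ε hε₀).2 ⟨inferInstance, fun c x => ?_,
      ((Algebra.TensorProduct.map ι'.symm.toAlgHom (AlgHom.id k D)).comp e).comp ι'.toAlgHom,
      fun a => ?_⟩
    · rw [Algebra.smul_def]
      rfl
    · change Algebra.TensorProduct.map ι'.symm.toAlgHom (AlgHom.id k D) (e (a : U)) = _
      rw [← sum_tensorCoord ε (e (a : U)), Fin.sum_univ_succ, he, map_add, map_sum]
      rfl

theorem ExpSub.Compatible.of_isSub {X Y : ExpSub (LHom.sumInl : L₀ →ᴸ dLang L₀ k d) U}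
    (hY : Y.Compatible) (h : X.IsSub Y) : X.Compatible := by
  obtain ⟨hle, hs, -⟩ := ExpSub.isSub_iff.1 h
  exact fun c x => (hs c x).symm.trans (hY c _)

/-- Scalar multiplication on a `𝒟`-field is determined by its values at `1`, and `1` lies in `X`. -/
theorem ExpSub.Compatible.of_isSub_of_models (hε₀ : ε 0 = 1)
    {X Y : ExpSub (LHom.sumInl : L₀ →ᴸ dLang L₀ k d) U}
    (hX : X.Compatible) (h : X.IsSub Y) (hY : Y.Models (dAxioms φ ε)) : Y.Compatible := by
  obtain ⟨hle, hs, -⟩ := ExpSub.isSub_iff.1 h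
  obtain ⟨g, hg⟩ := exists_scalarHom φ ε hε₀ hY
  intro c x
  have h1 : (1 : U) ∈ X.carrier := (subfieldOf φ X.carrier).one_mem
  have h2 := hs c ⟨1, h1⟩
  rw [hg, hX, mul_one, mul_one] at h2
  rw [hg, h2]

end Bridge

/-! ### Amalgams on `U`, and uniqueness of the structure between `A`, `B` and `M`. -/

section Amalgamation

variable {L₀ : FirstOrder.Language.{u, v}} {U : Type w} [L₀.Structure U] {k : Type u₁} {d : ℕ}

theorem ExpSub.IsSub.le {X Y : ExpSub (LHom.sumInl : L₀ →ᴸ dLang L₀ k d) U} (h : X.IsSub Y) :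
    X.carrier ≤ Y.carrier :=
  (ExpSub.isSub_iff.1 h).1

theorem ExpSub.IsSub.derM'_eq {X Y : ExpSub (LHom.sumInl : L₀ →ᴸ dLang L₀ k d) U} (h : X.IsSub Y)
    (i : Fin (d + 1)) (x : U) (hx : x ∈ X.carrier) :
    ((derM' L₀ k i (⟨x, h.le hx⟩ : Y.carrier) : Y.carrier) : U) =
      (derM' L₀ k i (⟨x, hx⟩ : X.carrier) : X.carrier) := by
  obtain ⟨hle, -, hd⟩ := ExpSub.isSub_iff.1 h
  refine Fin.cases ?_ (fun j => ?_) i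
  · rfl
  · exact hd j ⟨x, hx⟩

variable (φ : fieldLang →ᴸ L₀) [Field U] [CharZero U] [φ.IsExpansionOn U] [Field k]
  {D : Type v₂} [CommRing D] [Algebra k D] (ε : Module.Basis (Fin (d + 1)) k D) {ρ : D →ₐ[k] k}

omit [CharZero U] in
theorem commutesAt_of_models [Algebra k U] {X : ExpSub (LHom.sumInl : L₀ →ᴸ dLang L₀ k d) U}
    (hX : X.Models (commAxioms L₀ k d)) {e : U →ₐ[k] U ⊗[k] D}
    (he : ∀ (x : U) (hx : x ∈ X.carrier) (i : Fin (d + 1)),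
      tensorCoord ε i (e x) = (derM' L₀ k i (⟨x, hx⟩ : X.carrier) : X.carrier))
    {x : U} (hx : x ∈ X.carrier) : CommutesAt ε e x := by
  have hcomm : ∀ (i j : Fin (d + 1)) (x : X.carrier),
      derM' L₀ k i (derM' L₀ k j x) = derM' L₀ k j (derM' L₀ k i x) := by
    intro i j x
    refine Fin.cases ?_ (fun i => ?_) i
    · rfl
    · refine Fin.cases ?_ (fun j => ?_) j
      · rfl
      · exact realize_commAxioms.1 hX i j x
  intro i j
  rw [he x hx, he x hx, he _ (Subtype.prop _), he _ (Subtype.prop _)]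
  exact congrArg Subtype.val (hcomm i j ⟨x, hx⟩)

theorem exists_amalgam {T₀ : L₀.Theory} (hT₀ : U ⊨ T₀) (hε₀ : ε 0 = 1)
    (hρ : IsNilpotent (RingHom.ker ρ)) (hρε : ∀ i : Fin d, ρ (ε i.succ) = 0)
    {A B C : ExpSub (LHom.sumInl : L₀ →ᴸ dLang L₀ k d) U}
    (hA : A.Models (dAxioms φ ε)) (hB : B.Models (dAxioms φ ε)) (hCA : C.IsSub A)
    (hCB : C.IsSub B) (hdisj : AlgDisjoint (A.carrier : Set U) C.carrier B.carrier) :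
    ∃ M : ExpSub (LHom.sumInl : L₀ →ᴸ dLang L₀ k d) U, M.Models (theoryD φ T₀ ε) ∧
      A.IsSub M ∧ B.IsSub M ∧ (A.Models (commAxioms L₀ k d) → B.Models (commAxioms L₀ k d) →
        M.Models (commAxioms L₀ k d)) := by
  obtain ⟨g, hg⟩ := exists_scalarHom φ ε hε₀ hB
  -- The scalars come from `B`; they pass down to `C` and then up to `A`.
  let _ : Algebra k U := g.toAlgebra
  have hBc : B.Compatible := hg
  have hAc : A.Compatible := (hBc.of_isSub hCB).of_isSub_of_models φ ε hε₀ hCA hA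
  obtain ⟨eA, heA, -⟩ := exists_sectionHom φ ε hε₀ hA hAc
  obtain ⟨eB, heB, hkB⟩ := exists_sectionHom φ ε hε₀ hB hBc
  obtain ⟨e, he, heA', heB', hcomm⟩ := exists_section_extension (ρ := ρ) ε hε₀ hρ hρε
    (A := subfieldOf φ A.carrier) (B := subfieldOf φ B.carrier) (C := subfieldOf φ C.carrier)
    hCA.le hCB.le eA eB
    (fun x => by rw [← tensorCoord_zero_eq ε hε₀ hρε]; exact heA x x.2 0)
    (fun x => by rw [← tensorCoord_zero_eq ε hε₀ hρε]; exact heB x x.2 0) hkB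
    (fun x hx => tensorCoord_ext ε fun i => by
      rw [heA x (hCA.le hx), heB x (hCB.le hx)]
      exact (hCA.derM'_eq i x hx).trans (hCB.derM'_eq i x hx).symm)
    (by
      have h1 : Subfield.closure (C.carrier : Set U) = subfieldOf φ C.carrier :=
        Subfield.closure_eq (subfieldOf φ C.carrier)
      have h2 : Subfield.closure (B.carrier : Set U) = subfieldOf φ B.carrier :=
        Subfield.closure_eq (subfieldOf φ B.carrier)
      rw [AlgDisjoint, h1, h2] at hdisj
      exact hdisj)
  have heAx (x : U) (hx : x ∈ A.carrier) (i : Fin (d + 1)) :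
      tensorCoord ε i (e x) = (derM' L₀ k i (⟨x, hx⟩ : A.carrier) : A.carrier) := by
    rw [← heA x hx]
    exact congrArg _ (heA' ⟨x, hx⟩)
  have heBx (x : U) (hx : x ∈ B.carrier) (i : Fin (d + 1)) :
      tensorCoord ε i (e x) = (derM' L₀ k i (⟨x, hx⟩ : B.carrier) : B.carrier) := by
    rw [← heB x hx]
    exact congrArg _ (heB' ⟨x, hx⟩)
  obtain ⟨M, hMtop, hM, hMc, hMd⟩ := exists_expSub_top φ ε hT₀ hε₀ (e := e)
    (fun x => (tensorCoord_zero_eq ε hε₀ hρε _).trans (he x))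
  have hmem (x : U) : x ∈ M.carrier := hMtop ▸ trivial
  have hsub {X : ExpSub (LHom.sumInl : L₀ →ᴸ dLang L₀ k d) U} (hX : X.Compatible)
      (hXe : ∀ (x : U) (hx : x ∈ X.carrier) (i : Fin (d + 1)),
        tensorCoord ε i (e x) = (derM' L₀ k i (⟨x, hx⟩ : X.carrier) : X.carrier)) : X.IsSub M :=
    ExpSub.isSub_iff.2 ⟨fun x _ => hmem x, fun c x => (hMc c _).trans (hX c x).symm,
      fun i x => (hMd i _).trans (hXe x x.2 i.succ)⟩
  refine ⟨M, hM, hsub hAc heAx, hsub hBc heBx, fun hA' hB' => realize_commAxioms.2 ?_⟩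
  intro i j x
  have h1 := hcomm (fun x hx => commutesAt_of_models ε hA' heAx hx)
    (fun x hx => commutesAt_of_models ε hB' heBx hx) x i.succ j.succ
  apply Subtype.ext
  rw [hMd, hMd, hMd, hMd]
  exact h1

/-- Disjointness plays no role here: algebraicity of `S` over the compositum forces both closure
under the operators of `M` and uniqueness. -/
theorem exists_unique_expansion (hε₀ : ε 0 = 1)
    (hρ : IsNilpotent (RingHom.ker ρ)) (hρε : ∀ i : Fin d, ρ (ε i.succ) = 0)
    {T : (dLang L₀ k d).Theory} (hT : dAxioms φ ε ⊆ T)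
    {A B M : ExpSub (LHom.sumInl : L₀ →ᴸ dLang L₀ k d) U}
    (hA : A.Models (dAxioms φ ε)) (hM : M.Models T) (hAM : A.IsSub M)
    (hBM : B.IsSub M) {S : L₀.Substructure U} (hAS : A.carrier ≤ S) (hBS : B.carrier ≤ S)
    (hSM : S ≤ M.carrier)
    (hS : ∀ x ∈ S, IsAlgebraic (Subfield.closure ((A.carrier : Set U) ∪ B.carrier)) x) :
    ∃ X : ExpSub (LHom.sumInl : L₀ →ᴸ dLang L₀ k d) U, X.carrier = S ∧ X.IsSub M ∧
      ∀ Y : ExpSub (LHom.sumInl : L₀ →ᴸ dLang L₀ k d) U,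
        (Y.carrier = S ∧ Y.Models (univPart T) ∧ A.IsSub Y ∧ B.IsSub Y) ↔ Y = X := by
  obtain ⟨g, hg⟩ := exists_scalarHom φ ε hε₀ hA
  let _ : Algebra k U := g.toAlgebra
  have hAc : A.Compatible := hg
  have hMd : M.Models (dAxioms φ ε) := Theory.Model.mono hM hT
  have hMc : M.Compatible := hAc.of_isSub_of_models φ ε hε₀ hAM hMd
  obtain ⟨eA, -, hkA⟩ := exists_sectionHom φ ε hε₀ hA hAc
  obtain ⟨e, he, -⟩ := exists_sectionHom φ ε hε₀ hMd hMc
  have hk (c : k) : algebraMap k U c ∈ S := hAS (hkA c).1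
  have hAB : (A.carrier : Set U) ∪ B.carrier ⊆ subfieldOf φ S := Set.union_subset hAS hBS
  have hder (x : U) (hx : x ∈ S) (i : Fin (d + 1)) :
      ((derM' L₀ k i (⟨x, hSM hx⟩ : M.carrier) : M.carrier) : U) ∈ S := by
    rw [← he]
    refine tensorCoord_mem_of_isAlgebraic (ρ := ρ) ε hε₀ hρ hρε (K := subfieldOf φ S) hSM hk e
      (fun x => ?_) hAB ?_ x hx (hS x hx) i
    · rw [← tensorCoord_zero_eq ε hε₀ hρε]
      exact he x x.2 0
    · rintro y (hy | hy) i
      · rw [he y (hAM.le hy), hAM.derM'_eq i y hy]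
        exact hAS (Subtype.prop _)
      · rw [he y (hBM.le hy), hBM.derM'_eq i y hy]
        exact hBS (Subtype.prop _)
  let X : ExpSub (LHom.sumInl : L₀ →ᴸ dLang L₀ k d) U := ExpSub.mk' S
    (fun c x => ⟨algebraMap k U c * x, (subfieldOf φ S).mul_mem (hk c) x.2⟩)
    (fun i x => ⟨_, hder x x.2 i.succ⟩)
  have hXc : X.Compatible := fun _ _ => rfl
  have hXM : X.IsSub M := ExpSub.isSub_iff.2 ⟨hSM, fun c x => hMc c _, fun i x => rfl⟩
  have : Nonempty X.carrier := ⟨⟨0, (subfieldOf φ S).zero_mem⟩⟩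
  have hX : X.Models (univPart T) := hXM.models_univPart hM
  have hsubX {Z : ExpSub (LHom.sumInl : L₀ →ᴸ dLang L₀ k d) U} (hZM : Z.IsSub M)
      (hZS : Z.carrier ≤ S) : Z.IsSub X :=
    ExpSub.isSub_iff.2 ⟨hZS,
      fun c x => (hXc c _).trans ((hMc.of_isSub hZM) c x).symm,
      fun i x => hZM.derM'_eq i.succ x x.2⟩
  refine ⟨X, rfl, hXM, fun Y => ⟨?_, ?_⟩⟩
  · rintro ⟨hYS, hY, hAY, hBY⟩
    have hYd : Y.Models (dAxioms φ ε) := hY.of_univPart hT (isUniversal_dAxioms φ ε)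
    have hYc : Y.Compatible := hAc.of_isSub_of_models φ ε hε₀ hAY hYd
    obtain ⟨eY, heY, -⟩ := exists_sectionHom φ ε hε₀ hYd hYc
    have hYM : Y.carrier ≤ M.carrier := hYS.trans_le hSM
    refine ExpSub.eq_of_isSub (ExpSub.isSub_iff.2 ⟨hYS.le,
      fun c x => (hXc c _).trans (hYc c x).symm, fun i x => ?_⟩) hYS
    have hAB' : (A.carrier : Set U) ∪ B.carrier ⊆ subfieldOf φ Y.carrier :=
      Set.union_subset hAY.le hBY.le
    -- The sections of `M` and `Y` agree on `A ∪ B` and have the same residue, so they agree on all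
    -- elements algebraic over the compositum.
    have heq : e ⟨x, hYM x.2⟩ = eY ⟨x, x.2⟩ := by
      refine subfieldHom_eq_of_isNilpotent_sub (F := subfieldOf φ Y.carrier)
        (e.comp (Subfield.inclusion (S := subfieldOf φ Y.carrier)
          (T := subfieldOf φ M.carrier) hYM)) eY hAB' ?_ ⟨x, x.2⟩ (hS x (hYS ▸ x.2)) ?_
      · rintro y (hy | hy)
        · refine tensorCoord_ext ε fun i => ?_
          rw [heY y (hAY.le hy), hAY.derM'_eq i y hy]
          exact (he y (hAM.le hy) i).trans (hAM.derM'_eq i y hy)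
        · refine tensorCoord_ext ε fun i => ?_
          rw [heY y (hBY.le hy), hBY.derM'_eq i y hy]
          exact (he y (hBM.le hy) i).trans (hBM.derM'_eq i y hy)
      · refine isNilpotent_sub_of_tensorResidue_eq hρ ?_
        rw [← tensorCoord_zero_eq ε hε₀ hρε, ← tensorCoord_zero_eq ε hε₀ hρε]
        exact (he x (hYM x.2) 0).trans (heY x x.2 0).symm
    refine (he x (hYM x.2) i.succ).symm.trans ?_
    rw [heq]
    exact heY x x.2 i.succ
  · rintro rfl
    exact ⟨rfl, hX, hsubX hAM hAS, hsubX hBM hBS⟩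

end Amalgamation

/-! ### Derivation-likeness of both theories. -/

section Main

variable {L₀ : FirstOrder.Language.{u, v}} {U : Type w} [L₀.Structure U]

theorem acl_mono {A B : Set U} (h : A ⊆ B) : acl L₀ A ⊆ acl L₀ B :=
  fun _ ⟨s, hs, hfin, has⟩ => ⟨s, hs.mono h, hfin, has⟩

variable (φ : fieldLang →ᴸ L₀) [Field U] [CharZero U] [φ.IsExpansionOn U]
  {k : Type u₁} [Field k] {D : Type v₂} [CommRing D] [Algebra k D] {d : ℕ}
  (ε : Module.Basis (Fin (d + 1)) k D) {ρ : D →ₐ[k] k}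

/-- Both theories differ only in amalgamation, where commutation has to be carried over to `M`; the
rest holds for every `T` containing `theoryD φ T₀ ε`. -/
theorem isDerivationLike_of_amalgamation {T₀ : L₀.Theory} (hε₀ : ε 0 = 1)
    (hρ : IsNilpotent (RingHom.ker ρ)) (hρε : ∀ i : Fin d, ρ (ε i.succ) = 0) {κ : Cardinal.{w}}
    {ind : Set U → Set U → Set U → Prop} (hdisj : ImpliesAlgDisjoint L₀ κ ind)
    (hcomp : ImpliesCompositums L₀ κ ind) (hslim : IsVerySlim L₀ U)
    {T : (dLang L₀ k d).Theory} (hT : theoryD φ T₀ ε ⊆ T)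
    (hamalg : ∀ A B C : ExpSub (LHom.sumInl : L₀ →ᴸ dLang L₀ k d) U,
      A.Models (univPart T) → B.Models (univPart T) → C.IsSub A → C.IsSub B →
      AlgDisjoint (A.carrier : Set U) C.carrier B.carrier →
      ∃ M : ExpSub (LHom.sumInl : L₀ →ᴸ dLang L₀ k d) U, M.Models T ∧ A.IsSub M ∧ B.IsSub M) :
    IsDerivationLike (LHom.sumInl : L₀ →ᴸ dLang L₀ k d) T₀ T U κ ind where
  univPart_le σ hσ := by
    intro M v xs
    have hM : (M : Type _) ⊨ (LHom.sumInl : L₀ →ᴸ dLang L₀ k d).onTheory T₀ :=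
      Theory.Model.mono M.is_model (Set.subset_union_left.trans hT)
    let _ := (LHom.sumInl : L₀ →ᴸ dLang L₀ k d).reduct M
    have := LHom.isExpansionOn_reduct (LHom.sumInl : L₀ →ᴸ dLang L₀ k d) M
    have : (M : Type _) ⊨ T₀ := (LHom.onTheory_model _ _).1 hM
    have h := (LHom.realize_onSentence (M : Type _) (LHom.sumInl : L₀ →ᴸ dLang L₀ k d) σ).2
      (hσ.2.realize_sentence M)
    rw [Sentence.Realize, Formula.Realize] at h
    convert! h
  amalgamation A B C hA hB _ hAκ hBκ hCA hCB _ _ hind :=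
    hamalg A B C hA hB hCA hCB (hdisj _ _ _ hCA.le hCB.le hAκ hBκ hind)
  closure A B C hA _ _ hAκ hBκ _ _ hCA hCB hind M hM hAM hBM S hS hS' := by
    have hdT : dAxioms φ ε ⊆ T := Set.subset_union_right.trans hT
    -- Slimness speaks of `L₀`-substructures only. Since the compositum `F` is one, the algebraic
    -- closure of `A ∪ B` lies in the field-theoretic closure of `F`.
    obtain ⟨F, hF⟩ := hcomp _ _ _ hAκ hBκ hCA hCB hind
    have hABS : (A.carrier : Set U) ∪ B.carrier ⊆ S :=
      (Substructure.subset_closure (L := L₀)).trans hS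
    refine exists_unique_expansion φ ε hε₀ hρ hρε hdT
      (hA.of_univPart hdT (isUniversal_dAxioms φ ε)) hM hAM hBM
      (Set.subset_union_left.trans hABS) (Set.subset_union_right.trans hABS)
      (fun x hx => (hS' hx).2) fun x hx => ?_
    have h1 : x ∈ acl L₀ (F : Set U) :=
      acl_mono (hF ▸ Subfield.subset_closure) (hS' hx).1
    rw [hslim, hF] at h1
    have h2 : Subfield.closure
        (Subfield.closure ((A.carrier : Set U) ∪ B.carrier) : Set U) =
        Subfield.closure ((A.carrier : Set U) ∪ B.carrier) := Subfield.closure_eq _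
    rw [h2] at h1
    exact h1

end Main

end DerivLike

theorem mainTheorem11
    {L₀ : FirstOrder.Language.{u, v}} (φ : fieldLang →ᴸ L₀)
    (T₀ : L₀.Theory) (hT₀ : T₀.IsComplete) (hT₀' : IsModelComplete T₀)
    {U : Type w} [L₀.Structure U] (κ : Cardinal.{w}) (hU : IsMonster T₀ U κ)
    [Field U] [CharZero U] [φ.IsExpansionOn U]
    (ind : Set U → Set U → Set U → Prop) (hind : IsInvariant L₀ κ ind)
    {k : Type u₁} [Field k] [CharZero k]
    {D : Type v₂} [CommRing D] [Algebra k D] [IsLocalRing D]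
    (hD : Function.Bijective (algebraMap k (IsLocalRing.ResidueField D)))
    {d : ℕ} (ε : Module.Basis (Fin (d + 1)) k D) (hε₀ : ε 0 = 1)
    (hε : ∀ i : Fin d, ε i.succ ∈ IsLocalRing.maximalIdeal D)
    (hdisj : ImpliesAlgDisjoint L₀ κ ind) (hcomp : ImpliesCompositums L₀ κ ind)
    (hslim : IsVerySlim L₀ U) :
    IsDerivationLike (LHom.sumInl : L₀ →ᴸ dLang L₀ k d) T₀ (theoryD φ T₀ ε) U κ ind ∧
    IsDerivationLike (LHom.sumInl : L₀ →ᴸ dLang L₀ k d) T₀ (theoryDStar φ T₀ ε) U κ ind := by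
  obtain ⟨ρ, hρ, hρε⟩ := exists_residue_algHom hD ε hε
  have hd : dAxioms φ ε ⊆ theoryD φ T₀ ε := Set.subset_union_right
  have hd' : theoryD φ T₀ ε ⊆ theoryDStar φ T₀ ε := Set.subset_union_left
  have hc : commAxioms L₀ k d ⊆ theoryDStar φ T₀ ε := Set.subset_union_right
  refine ⟨isDerivationLike_of_amalgamation φ ε hε₀ hρ hρε hdisj hcomp hslim subset_rfl ?_,
    isDerivationLike_of_amalgamation φ ε hε₀ hρ hρε hdisj hcomp hslim hd' ?_⟩
  · intro A B C hA hB hCA hCB h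
    obtain ⟨M, hM, hAM, hBM, -⟩ := exists_amalgam φ ε hU.model hε₀ hρ hρε
      (hA.of_univPart hd (isUniversal_dAxioms φ ε)) (hB.of_univPart hd (isUniversal_dAxioms φ ε))
      hCA hCB h
    exact ⟨M, hM, hAM, hBM⟩
  · intro A B C hA hB hCA hCB h
    obtain ⟨M, hM, hAM, hBM, hcomm⟩ := exists_amalgam φ ε hU.model hε₀ hρ hρε
      (hA.of_univPart (hd.trans hd') (isUniversal_dAxioms φ ε))
      (hB.of_univPart (hd.trans hd') (isUniversal_dAxioms φ ε)) hCA hCB h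
    exact ⟨M, Theory.model_union_iff.2 ⟨hM, hcomm (hA.of_univPart hc isUniversal_commAxioms)
      (hB.of_univPart hc isUniversal_commAxioms)⟩, hAM, hBM⟩
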